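/- Let $d\ge 1$, $t>0$, put $\rho(d)=\pi^{d/2}/\Gamma\big(\tfrac{d+2}{2}\big)$ and $c=\rho(d)\,t$, and let $(\lambda_n)$ be a sequence of nonnegative integers with $\lambda_n/n\to \rho(d)t/2$. Let $\mathcal G(n,\lambda_n)$ be the random graph whose $n$ nodes are placed independently and uniformly in $[0,1]^d$ and whose edge set is, independently of the positions, chosen uniformly among all sets of $\lambda_n$ edges between the $n$ nodes (this is possible for all large $n$). Let $D_X(0)$ be the proportion of detached (degree-zero) nodes. For every $y\in[0,1)$ with $y>1-c$ the equation $$\frac{1-e^{-\alpha}}{\alpha}=\frac{1-y}{c}$$ has exactly one solution $\alpha=\alpha(y,t)$ among the nonzero reals, and $\alpha(y,t)>0$. As $n\to\infty$, $D_X(0)$ satisfies a large deviation principle on $[0,1]$ with speed $n$ and with the good, convex rate function $\xi:[0,1]\to[0,\infty]$ given by $$\xi(y)=\begin{cases} y\log\dfrac{y}{e^{-c}}+(1-y)\log\dfrac{1-y}{1-e^{-c}}+c\log\dfrac{\alpha(y,t)}{c}+(1-y)\log\dfrac{e^{c}-1}{e^{\alpha(y,t)}-1}, & 1-c<y<1,\\[2mm]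 (1-c)\log(1-c)+c, & y=1-c,\\[1mm] \infty, & y<1-c\ \text{ or }\ y=1,\end{cases}$$ with the convention $0\log 0=0$. (The values at $y=1-c$ and $y=1$ are the limits of the first line as $\alpha\to0$ and $\alpha\to\infty$.) -/

import Mathlib

open MeasureTheory ProbabilityTheory Filter Topology unitInterval

noncomputable section

/-- The constant `π ^ (d / 2) / Γ ((d + 2) / 2)`, the volume of the unit ball of `ℝ ^ d`. -/
def rho (d : ℕ) : ℝ :=
  Real.pi ^ ((d : ℝ) / 2) / Real.Gamma (((d : ℝ) + 2) / 2)

/-- The outcomes of a random graph on `[0,1]^d` with `n` nodes: the positions of the nodes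
together with the graph on the (labels of the) nodes. -/
abbrev SpatialGraph (d n : ℕ) : Type :=
  (Fin n → Fin d → I) × SimpleGraph (Fin n)

/-- The law of the random graph with `n` nodes and `m` edges on `[0,1]^d`: the nodes are placed
independently and uniformly in `[0,1]^d` (`volume` is the product of uniform laws), and, independently
of the positions, the edge set is uniform among all sets of `m` edges. It is the zero
measure if `m > n.choose 2`, when no such graph exists. -/
def spatialGraphLaw (d n m : ℕ) : Measure (SpatialGraph d n) :=
  (volume : Measure (Fin n → Fin d → I)).prod
    (uniformOn {G : SimpleGraph (Fin n) | G.edgeSet.ncard = m})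

/-- The degree distribution: the proportion of nodes of degree `r`. -/
def degreeDist {d n : ℕ} (X : SpatialGraph d n) (r : ℕ) : ℝ :=
  ({v : Fin n | (X.2.neighborSet v).ncard = r}.ncard : ℝ) / n

theorem degreeDist_mem {d n : ℕ} (X : SpatialGraph d n) (r : ℕ) :
    degreeDist X r ∈ Set.Icc (0 : ℝ) 1 := by
  refine ⟨by unfold degreeDist; positivity, ?_⟩
  refine div_le_one_of_le₀ ?_ (Nat.cast_nonneg n)
  have h := Set.ncard_le_card {v : Fin n | (X.2.neighborSet v).ncard = r}
  rw [Nat.card_eq_fintype_card, Fintype.card_fin] at h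
  exact_mod_cast h

/-- The proportion of detached nodes (nodes of degree zero), as an element of `[0,1]`. -/
def detachedProportion {d n : ℕ} (X : SpatialGraph d n) : I :=
  ⟨degreeDist X 0, degreeDist_mem X 0⟩

/-- Good rate functions: `[0, ∞]`-valued, lower semicontinuous, with compact sublevel sets. -/
structure IsGoodRateFunction {S : Type*} [TopologicalSpace S] (J : S → EReal) : Prop where
  nonneg : ∀ x, 0 ≤ J x
  lowerSemicontinuous : LowerSemicontinuous J
  isCompact_sublevel : ∀ a : ℝ, IsCompact {x | J x ≤ (a : EReal)}

/-- Convexity of an extended-real-valued function on `[0,1]`: its epigraph is convex. -/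
def IsConvexOnUnitInterval (J : I → EReal) : Prop :=
  Convex ℝ {p : ℝ × ℝ | ∃ x : I, (x : ℝ) = p.1 ∧ J x ≤ (p.2 : EReal)}

/-- The random elements `Y n` of `S`, defined under the laws `P n`, satisfy a large deviation
principle with speed `n` and rate function `J`. -/
structure SatisfiesLDP {S : Type*} [TopologicalSpace S] {Ω : ℕ → Type*}
    [∀ n, MeasurableSpace (Ω n)] (P : ∀ n, Measure (Ω n)) (Y : ∀ n, Ω n → S)
    (J : S → EReal) : Prop where
  upper : ∀ F : Set S, IsClosed F →
    limsup (fun n : ℕ => ENNReal.log (P n {ω | Y n ω ∈ F}) / ((n : ℝ) : EReal)) atTop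
      ≤ -(⨅ y ∈ F, J y)
  lower : ∀ U : Set S, IsOpen U →
    -(⨅ y ∈ U, J y)
      ≤ liminf (fun n : ℕ => ENNReal.log (P n {ω | Y n ω ∈ U}) / ((n : ℝ) : EReal)) atTop

open scoped Classical in
/-- The rate function at `y ∈ [0,1]` for mean degree `c > 0`, where `a` is the parameter
solving `(1 - exp (-a)) / a = (1 - y) / c` if `1 - c < y < 1`. At `y = 1 - c` and `y = 1`, where
this equation has no solution `a > 0`, the value is the limit for `a → 0` and `a → ∞`. -/
def detachedRate (c a y : ℝ) : EReal :=
  if y < 1 - c ∨ y = 1 then ⊤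
  else if y = 1 - c then ((y * Real.log y + c : ℝ) : EReal)
  else ((y * Real.log (y / Real.exp (-c))
      + (1 - y) * Real.log ((1 - y) / (1 - Real.exp (-c)))
      + c * Real.log (a / c)
      + (1 - y) * Real.log ((Real.exp c - 1) / (Real.exp a - 1)) : ℝ) : EReal)

end

/-! The positions are independent of the graph, so only a uniform graph with m ≈ cn/2 edges matters.
Let P_n(j) be the probability that exactly j of the n nodes are not detached. It is
C(n,j)·s(j,m)/C(C(n,2),m), where s(j,m) = `spanningCount j m` does not depend on n. No asymptotics
of s are needed: comparing n nodes with N = ⌈νn⌉ nodes and the same m cancels s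
(`supportProb_eq_mul`), and P_n(j) = [C(n,j)/C(N,j)]·[C(C(N,2),m)/C(C(n,2),m)]·P_N(j). By Stirling
the prefactor is exp(-n·`shiftRate c ν (1 - j/n)`) up to e^{o(n)}, uniformly in j.

For the upper bound, P_N(j) ≤ 1 and ν is free. For the lower bound, the graph on N nodes has mean
degree about c/ν and hence a proportion about e^{-c/ν} of detached nodes. At ν = c/α(y) its typical
number of non-detached nodes is (1-y)n, so a second moment argument
(`eventually_exists_le_supportProb`) makes P_N(j) at least of order 1/N for some j close to (1-y)n.
This ν is therefore optimal.

The rate is thus a supremum of `shiftRate` over ν > 1-y. Gibbs' inequality bounds `shiftRate` at ν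
by `tiltRate` at b = c/ν, with equality at b = α, so the rate is also the supremum over b > 0 of
`tiltRate c b` (`lt_detachedRate_iff`). These functions are continuous and convex in y, which gives
goodness and convexity of the rate. Convexity in turn extends the lower bound to y = 0 and y = 1-c.
-/

/-! ### Counting graphs by their number of non-detached nodes. -/

/-- The number of graphs with `m` edges on `j` labelled nodes, none of which is detached. -/
noncomputable def spanningCount (j m : ℕ) : ℕ :=
  {H : SimpleGraph (Fin j) | H.edgeSet.ncard = m ∧ H.support = Set.univ}.ncard

theorem ncard_edgeSet_map {V W : Type*} (f : V ↪ W) (G : SimpleGraph V) :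
    (G.map f).edgeSet.ncard = G.edgeSet.ncard := by
  rw [SimpleGraph.edgeSet_map]
  exact Set.ncard_image_of_injective _ f.sym2Map.injective

theorem map_comap_of_support_subset {V W : Type*} (f : V ↪ W) (G : SimpleGraph W)
    (h : G.support ⊆ Set.range f) : (G.comap f).map f = G := by
  ext u v
  rw [SimpleGraph.map_adj]
  constructor
  · rintro ⟨u, v, h, rfl, rfl⟩
    exact h
  · intro huv
    obtain ⟨a, rfl⟩ := h (G.mem_support.2 ⟨v, huv⟩)
    obtain ⟨b, rfl⟩ := h (G.mem_support.2 ⟨_, huv.symm⟩)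
    exact ⟨a, b, huv, rfl, rfl⟩

/-- An enumeration of `S` transports graphs without detached nodes on `Fin S.card` bijectively to
the graphs with support exactly `S`; so the count sees only the size of `S`. -/
theorem ncard_graphs_support_eq {n m : ℕ} (S : Finset (Fin n)) :
    {G : SimpleGraph (Fin n) | G.edgeSet.ncard = m ∧ G.support = S}.ncard
      = spanningCount S.card m := by
  obtain ⟨f, hf⟩ : ∃ f : Fin S.card ↪ Fin n, Set.range f = S :=
    ⟨(S.orderEmbOfFin rfl).toEmbedding, S.range_orderEmbOfFin rfl⟩
  have h : {G : SimpleGraph (Fin n) | G.edgeSet.ncard = m ∧ G.support = S}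
      = SimpleGraph.map f ''
        {H : SimpleGraph (Fin S.card) | H.edgeSet.ncard = m ∧ H.support = Set.univ} := by
    ext G
    constructor
    · rintro ⟨h1, h2⟩
      have hG := map_comap_of_support_subset f G (by rw [h2, hf])
      refine ⟨G.comap f, ⟨?_, ?_⟩, hG⟩
      · rw [← ncard_edgeSet_map f, hG, h1]
      · have := SimpleGraph.support_map f (G.comap f)
        rw [hG, h2, ← hf, ← Set.image_univ] at this
        exact (f.injective.image_injective this).symm
    · rintro ⟨H, ⟨h1, h2⟩, rfl⟩
      refine ⟨by rw [ncard_edgeSet_map, h1], ?_⟩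
      rw [SimpleGraph.support_map, h2, Set.image_univ, hf]
  rw [h, Set.ncard_image_of_injective _ (SimpleGraph.map_injective f), spanningCount]

theorem ncard_graphs_support_ncard_eq (n m j : ℕ) :
    {G : SimpleGraph (Fin n) | G.edgeSet.ncard = m ∧ G.support.ncard = j}.ncard
      = n.choose j * spanningCount j m := by
  classical
  have h : ((Finset.univ.filter fun G : SimpleGraph (Fin n) =>
      G.edgeSet.ncard = m ∧ G.support.ncard = j : Finset _) : Set (SimpleGraph (Fin n)))
      = {G : SimpleGraph (Fin n) | G.edgeSet.ncard = m ∧ G.support.ncard = j} := by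
    ext; simp
  rw [← h, Set.ncard_coe_finset,
    Finset.card_eq_sum_card_fiberwise (f := fun G : SimpleGraph (Fin n) => G.support.toFinset)
      (t := Finset.powersetCard j Finset.univ)]
  · rw [Finset.sum_congr rfl (g := fun _ => spanningCount j m), Finset.sum_const,
      Finset.card_powersetCard, Finset.card_univ, Fintype.card_fin, smul_eq_mul]
    intro S hS
    rw [Finset.mem_powersetCard] at hS
    rw [← hS.2, ← ncard_graphs_support_eq, ← Set.ncard_coe_finset]
    congr 1
    ext G
    simp only [Finset.coe_filter, Finset.mem_filter, Finset.mem_univ, true_and, Set.mem_ofPred_eq]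
    constructor
    · rintro ⟨⟨h1, -⟩, h2⟩
      exact ⟨h1, by rw [← h2, Set.coe_toFinset]⟩
    · rintro ⟨h1, h2⟩
      refine ⟨⟨h1, ?_⟩, ?_⟩
      · rw [h2, Set.ncard_coe_finset]
      · ext v; simp [h2]
  · intro G hG
    simp only [Finset.coe_filter, Finset.mem_univ, true_and, Set.mem_ofPred_eq] at hG
    simp only [Finset.mem_coe, Finset.mem_powersetCard, Finset.subset_univ, true_and]
    rw [← hG.2, Set.ncard_eq_toFinset_card']

theorem ncard_graphs_edges_eq (n m : ℕ) :
    {G : SimpleGraph (Fin n) | G.edgeSet.ncard = m}.ncard = (n.choose 2).choose m := by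
  classical
  let D : Finset (Sym2 (Fin n)) := Finset.univ.filter fun e => ¬ e.IsDiag
  have hD : D.card = n.choose 2 := by
    rw [← Fintype.card_subtype, Sym2.card_subtype_not_diag, Fintype.card_fin]
  rw [← hD, ← Finset.card_powersetCard, ← Set.ncard_coe_finset]
  refine Set.ncard_congr (fun G _ => G.edgeFinset) ?_ ?_ ?_
  · intro G hG
    simp only [Finset.mem_coe, Finset.mem_powersetCard]
    refine ⟨fun e he => ?_, ?_⟩
    · simp only [D, Finset.mem_filter, Finset.mem_univ, true_and]
      exact G.not_isDiag_of_mem_edgeSet (SimpleGraph.mem_edgeFinset.1 he)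
    · rw [← Set.ncard_coe_finset, SimpleGraph.coe_edgeFinset]
      exact hG
  · intro G H _ _ h
    exact SimpleGraph.edgeFinset_inj.1 h
  · intro s hs
    simp only [Finset.mem_coe, Finset.mem_powersetCard] at hs
    have hE : (SimpleGraph.fromEdgeSet (s : Set (Sym2 (Fin n)))).edgeSet = s := by
      rw [SimpleGraph.edgeSet_fromEdgeSet]
      ext e
      simp only [Set.mem_sdiff, Finset.mem_coe, and_iff_left_iff_imp]
      intro he
      have := hs.1 he
      simp only [D, Finset.mem_filter, Finset.mem_univ, true_and] at this
      exact this
    refine ⟨SimpleGraph.fromEdgeSet (s : Set (Sym2 (Fin n))), ?_, ?_⟩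
    · rw [Set.mem_ofPred_eq, hE, Set.ncard_coe_finset, hs.2]
    · ext e
      rw [← Finset.mem_coe, SimpleGraph.coe_edgeFinset, hE, Finset.mem_coe]

theorem ncard_graphs_support_mem (n m : ℕ) (p : ℕ → Prop) [DecidablePred p] :
    {G : SimpleGraph (Fin n) | G.edgeSet.ncard = m ∧ p G.support.ncard}.ncard
      = ∑ j ∈ (Finset.range (n + 1)).filter p, n.choose j * spanningCount j m := by
  classical
  have h : ((Finset.univ.filter fun G : SimpleGraph (Fin n) =>
      G.edgeSet.ncard = m ∧ p G.support.ncard : Finset _) : Set (SimpleGraph (Fin n)))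
      = {G : SimpleGraph (Fin n) | G.edgeSet.ncard = m ∧ p G.support.ncard} := by
    ext; simp
  rw [← h, Set.ncard_coe_finset,
    Finset.card_eq_sum_card_fiberwise (f := fun G : SimpleGraph (Fin n) => G.support.ncard)
      (t := (Finset.range (n + 1)).filter p)]
  · refine Finset.sum_congr rfl fun j hj => ?_
    rw [← ncard_graphs_support_ncard_eq, ← Set.ncard_coe_finset]
    congr 1
    ext G
    simp only [Finset.coe_filter, Finset.mem_filter, Finset.mem_univ, true_and, Set.mem_ofPred_eq]
    constructor
    · rintro ⟨⟨h1, -⟩, h2⟩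
      exact ⟨h1, h2⟩
    · rintro ⟨h1, h2⟩
      exact ⟨⟨h1, h2 ▸ (Finset.mem_filter.1 hj).2⟩, h2⟩
  · intro G hG
    simp only [Finset.coe_filter, Finset.mem_univ, true_and, Set.mem_ofPred_eq,
      Finset.mem_range] at hG ⊢
    refine ⟨?_, hG.2⟩
    have := Set.ncard_le_card G.support
    rw [Nat.card_eq_fintype_card, Fintype.card_fin] at this
    omega

/-- Classifying all graphs by the size of their support. Used for varying `n`, this identity is the
only information about `spanningCount` that the moment computations need. -/
theorem sum_choose_mul_spanningCount (n m : ℕ) :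
    ∑ j ∈ Finset.range (n + 1), n.choose j * spanningCount j m = (n.choose 2).choose m := by
  have := ncard_graphs_support_mem n m (fun _ => True)
  simp only [and_true, Finset.filter_true] at this
  rw [← this, ncard_graphs_edges_eq]

theorem degreeDist_zero {d n : ℕ} (X : SpatialGraph d n) :
    degreeDist X 0 = ((n : ℝ) - X.2.support.ncard) / n := by
  have h : {v : Fin n | (X.2.neighborSet v).ncard = 0} = X.2.supportᶜ := by
    ext v
    rw [Set.mem_ofPred_eq, Set.ncard_eq_zero, Set.mem_compl_iff, SimpleGraph.mem_support,
      Set.eq_empty_iff_forall_notMem]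
    simp
  have h2 := Set.ncard_add_ncard_compl X.2.support
  rw [Nat.card_eq_fintype_card, Fintype.card_fin] at h2
  rw [degreeDist, h]
  congr 1
  rw [eq_sub_iff_add_eq]
  exact_mod_cast (add_comm _ _).trans h2

theorem measurableSet_simpleGraph {V : Type*} [Finite V] (s : Set (SimpleGraph V)) :
    MeasurableSet s := by
  have : MeasurableSingletonClass (SimpleGraph V) := by
    refine ⟨fun G => ⟨{G.Adj}, measurableSet_singleton _, ?_⟩⟩
    ext H
    exact SimpleGraph.adj_inj
  exact s.toFinite.measurableSet

theorem uniformOn_simpleGraph_apply {V : Type*} [Finite V] (A B : Set (SimpleGraph V)) :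
    uniformOn A B = (A.ncard : ENNReal)⁻¹ * (A ∩ B).ncard := by
  rw [uniformOn, cond_apply (measurableSet_simpleGraph A),
    Measure.count_apply (measurableSet_simpleGraph _),
    Measure.count_apply (measurableSet_simpleGraph _)]
  rw [← A.toFinite.cast_ncard_eq, ← (A ∩ B).toFinite.cast_ncard_eq,
    ENat.toENNReal_coe, ENat.toENNReal_coe]

/-- The probability that exactly `n - j` of `n` nodes are detached, if there are `m` edges. -/
noncomputable def supportProb (n m j : ℕ) : ℝ :=
  (n.choose j * spanningCount j m : ℕ) / ((n.choose 2).choose m : ℕ)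

theorem supportProb_nonneg (n m j : ℕ) : 0 ≤ supportProb n m j := by
  unfold supportProb; positivity

theorem supportProb_le_one (n m j : ℕ) : supportProb n m j ≤ 1 := by
  unfold supportProb
  refine div_le_one_of_le₀ ?_ (Nat.cast_nonneg _)
  rw [Nat.cast_le]
  rcases lt_or_ge n j with h | h
  · rw [Nat.choose_eq_zero_of_lt h, zero_mul]; exact Nat.zero_le _
  · rw [← sum_choose_mul_spanningCount n m]
    exact Finset.single_le_sum (f := fun j => n.choose j * spanningCount j m)
      (fun _ _ => Nat.zero_le _) (Finset.mem_range.2 (by omega))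

-- The positions integrate out. The bound on `m` makes the conditioning event nonempty, so that the
-- law is a probability measure.
open scoped Classical in
theorem spatialGraphLaw_detachedProportion (d n m : ℕ) (hm : m ≤ n.choose 2) (S : Set I) :
    spatialGraphLaw d n m {X | detachedProportion X ∈ S}
      = ENNReal.ofReal (∑ j ∈ (Finset.range (n + 1)).filter
          (fun j : ℕ => ((n : ℝ) - j) / n ∈ Subtype.val '' S), supportProb n m j) := by
  have h : {X : SpatialGraph d n | detachedProportion X ∈ S}
      = Set.univ ×ˢ {G : SimpleGraph (Fin n) |
          ((n : ℝ) - G.support.ncard) / n ∈ Subtype.val '' S} := by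
    ext X
    simp only [Set.mem_ofPred_eq, Set.mem_prod, Set.mem_univ, true_and]
    rw [← degreeDist_zero X]
    exact (Subtype.val_injective.mem_set_image (s := S) (a := detachedProportion X)).symm
  have hT : 0 < (n.choose 2).choose m := Nat.choose_pos hm
  rw [spatialGraphLaw, h, Measure.prod_prod, measure_univ, one_mul, uniformOn_simpleGraph_apply,
    ncard_graphs_edges_eq]
  have h2 := ncard_graphs_support_mem n m (fun j : ℕ => ((n : ℝ) - j) / n ∈ Subtype.val '' S)
  rw [Set.ofPred_and] at h2
  rw [h2]
  simp only [supportProb]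
  rw [← Finset.sum_div, ENNReal.ofReal_div_of_pos (by exact_mod_cast hT), ENNReal.div_eq_inv_mul,
    ← Nat.cast_sum, ENNReal.ofReal_natCast, ENNReal.ofReal_natCast]

/-! ### The equation defining α. -/

/-- The quotient is the slope of the secant of `exp` between `-a` and `0`, which is strictly
monotone by strict convexity. -/
theorem one_sub_exp_neg_div_lt {a b : ℝ} (ha : a ≠ 0) (hb : b ≠ 0) (hab : a < b) :
    (1 - Real.exp (-b)) / b < (1 - Real.exp (-a)) / a := by
  have h := strictConvexOn_exp.secant_strict_mono (Set.mem_univ 0) (Set.mem_univ (-b))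
    (Set.mem_univ (-a)) (neg_ne_zero.2 hb) (neg_ne_zero.2 ha) (neg_lt_neg hab)
  rw [Real.exp_zero, sub_zero, sub_zero, div_neg, div_neg, ← neg_div, ← neg_div, neg_sub,
    neg_sub] at h
  exact h

theorem exists_one_sub_exp_neg_div_eq {q : ℝ} (h0 : 0 < q) (h1 : q < 1) :
    ∃ a : ℝ, 0 < a ∧ (1 - Real.exp (-a)) / a = q := by
  have hq : 1 < 1 / q := by rwa [one_lt_div h0]
  -- Half of the largest `b` with `q * (1 + b) ≤ 1`; then `1 - exp (-b) ≥ b / (1 + b) ≥ q * b`, so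
  -- the function below is nonnegative at `b`, while it is negative at `1 / q`.
  set b := (1 / q - 1) / 2 with hb
  have hb0 : 0 < b := by linarith
  have hbq : b < 1 / q := by linarith
  have hcont : ContinuousOn (fun a : ℝ => 1 - Real.exp (-a) - q * a) (Set.Icc b (1 / q)) := by
    fun_prop
  have hmem : (0 : ℝ) ∈ Set.Icc (1 - Real.exp (-(1 / q)) - q * (1 / q))
      (1 - Real.exp (-b) - q * b) := by
    constructor
    · rw [mul_one_div_cancel h0.ne']
      linarith [Real.exp_pos (-(1 / q))]
    · have h2 : Real.exp (-b) ≤ 1 / (1 + b) := by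
        rw [Real.exp_neg, ← one_div]
        exact one_div_le_one_div_of_le (by linarith) (by linarith [Real.add_one_le_exp b])
      have h3 : q * b ≤ 1 - 1 / (1 + b) := by
        have h4 : 1 - 1 / (1 + b) = b / (1 + b) := by field_simp; ring
        rw [h4, le_div_iff₀ (by linarith)]
        have h5 : q * (1 + b) ≤ 1 := by
          have : 1 + b ≤ 1 / q := by linarith
          calc q * (1 + b) ≤ q * (1 / q) := by gcongr
            _ = 1 := mul_one_div_cancel h0.ne'
        nlinarith
      linarith
  obtain ⟨a, ha, h⟩ := intermediate_value_Icc' hbq.le hcont hmem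
  have ha0 : 0 < a := hb0.trans_le ha.1
  refine ⟨a, ha0, ?_⟩
  rw [div_eq_iff ha0.ne']
  simp only at h
  linarith

theorem one_sub_exp_neg_div_inj {a b : ℝ} (ha : a ≠ 0) (hb : b ≠ 0)
    (h : (1 - Real.exp (-a)) / a = (1 - Real.exp (-b)) / b) : a = b := by
  rcases lt_trichotomy a b with hab | hab | hab
  · exact absurd h (one_sub_exp_neg_div_lt ha hb hab).ne'
  · exact hab
  · exact absurd h (one_sub_exp_neg_div_lt hb ha hab).ne

/-! ### Variational formulas for the rate. -/

/-- The exponent of the bound for the proportion `y` of detached nodes that comes from the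
generating function of the non-detached nodes at `a`. -/
noncomputable def tiltRate (c a y : ℝ) : ℝ :=
  y * Real.log y + (1 - y) * Real.log (1 - y) + c - c * Real.log c + c * Real.log a
    - (1 - y) * Real.log (Real.exp a - 1)

/-- The exponent of the bound for the proportion `y` of detached nodes among `n` nodes that comes
from a comparison with `ν * n` nodes. -/
noncomputable def shiftRate (c ν y : ℝ) : ℝ :=
  y * Real.log y + ν * Real.log ν - (ν - (1 - y)) * Real.log (ν - (1 - y)) - c * Real.log ν

/-- The derivative in `b` is a positive factor times the difference of the values of `(1 - exp (-x))
/ x` at `b` and at `a`. That function decreases, so `a` is the global maximum. -/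
theorem tiltRate_le_of_eq {c y a b : ℝ} (hc : 0 < c) (ha : 0 < a)
    (h : (1 - Real.exp (-a)) / a = (1 - y) / c) (hb : 0 < b) :
    tiltRate c b y ≤ tiltRate c a y := by
  set K : ℝ → ℝ := fun b => c * Real.log b - (1 - y) * Real.log (Real.exp b - 1) with hK
  have hder : ∀ b : ℝ, 0 < b → HasDerivAt K
      (c * b⁻¹ - (1 - y) * (Real.exp b / (Real.exp b - 1))) b := by
    intro b hb
    have h1 : Real.exp b - 1 ≠ 0 := by linarith [Real.add_one_lt_exp hb.ne']
    exact ((Real.hasDerivAt_log hb.ne').const_mul c).sub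
      ((((Real.hasDerivAt_exp b).sub_const 1).log h1).const_mul (1 - y))
  have hr : 1 - y = c * ((1 - Real.exp (-a)) / a) := by rw [h]; field_simp
  have hform : ∀ b : ℝ, 0 < b → c * b⁻¹ - (1 - y) * (Real.exp b / (Real.exp b - 1))
      = c * (Real.exp b / (Real.exp b - 1))
        * ((1 - Real.exp (-b)) / b - (1 - Real.exp (-a)) / a) := by
    intro b hb
    have h1 : Real.exp b - 1 ≠ 0 := by linarith [Real.add_one_lt_exp hb.ne']
    have h2 : b⁻¹ = Real.exp b / (Real.exp b - 1) * ((1 - Real.exp (-b)) / b) := by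
      rw [Real.exp_neg]
      have := Real.exp_pos b
      field_simp
    rw [hr, h2]
    ring
  have hpos : ∀ b : ℝ, 0 < b → 0 ≤ c * (Real.exp b / (Real.exp b - 1)) := by
    intro b hb
    have h1 : 0 < Real.exp b - 1 := by linarith [Real.add_one_lt_exp hb.ne']
    positivity
  have key : K b ≤ K a := by
    rcases le_total b a with hba | hab
    · refine monotoneOn_of_deriv_nonneg (convex_Icc b a)
        (fun x hx => (hder x (hb.trans_le hx.1)).continuousAt.continuousWithinAt)
        (fun x hx => ?_) (fun x hx => ?_) (Set.left_mem_Icc.2 hba) (Set.right_mem_Icc.2 hba) hba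
      all_goals rw [interior_Icc] at hx
      · exact (hder x (hb.trans hx.1)).differentiableAt.differentiableWithinAt
      · have hx0 := hb.trans hx.1
        rw [(hder x hx0).deriv, hform x hx0]
        exact mul_nonneg (hpos x hx0)
          (sub_nonneg.2 (one_sub_exp_neg_div_lt hx0.ne' ha.ne' hx.2).le)
    · refine antitoneOn_of_deriv_nonpos (convex_Icc a b)
        (fun x hx => (hder x (ha.trans_le hx.1)).continuousAt.continuousWithinAt)
        (fun x hx => ?_) (fun x hx => ?_) (Set.left_mem_Icc.2 hab) (Set.right_mem_Icc.2 hab) hab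
      all_goals rw [interior_Icc] at hx
      · exact (hder x (ha.trans hx.1)).differentiableAt.differentiableWithinAt
      · have hx0 := ha.trans hx.1
        rw [(hder x hx0).deriv, hform x hx0]
        exact mul_nonpos_of_nonneg_of_nonpos (hpos x hx0)
          (sub_nonpos.2 (one_sub_exp_neg_div_lt ha.ne' hx0.ne' hx.1).le)
  simp only [hK] at key
  unfold tiltRate
  linarith

theorem mul_log_div_le {x u : ℝ} (hx : 0 ≤ x) (hu : 0 < u) :
    x * Real.log u - x * Real.log x ≤ u - x := by
  rcases hx.eq_or_lt with rfl | hx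
  · simpa using hu.le
  · have := Real.log_le_sub_one_of_pos (div_pos hu hx)
    rw [Real.log_div hu.ne' hx.ne'] at this
    calc x * Real.log u - x * Real.log x = x * (Real.log u - Real.log x) := by ring
      _ ≤ x * (u / x - 1) := by gcongr
      _ = u - x := by field_simp

theorem log_one_sub_exp_neg {a : ℝ} (ha : 0 < a) :
    Real.log (1 - Real.exp (-a)) = Real.log (Real.exp a - 1) - a := by
  have h1 : Real.exp a - 1 ≠ 0 := by linarith [Real.add_one_lt_exp ha.ne']
  have h : 1 - Real.exp (-a) = (Real.exp a - 1) / Real.exp a := by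
    rw [Real.exp_neg]
    have := Real.exp_pos a
    field_simp
  rw [h, Real.log_div h1 (Real.exp_ne_zero _), Real.log_exp]

/-- Gibbs' inequality for splitting mass `ν` into `1 - y` and `ν - (1 - y)`, against the split in
proportions `1 - exp (-c/ν)` and `exp (-c/ν)`: the linear errors of the two applications of
`mul_log_div_le` cancel. -/
theorem shiftRate_le_tiltRate {c ν y : ℝ} (hc : 0 < c) (hν : 0 < ν) (hy : y ≤ 1)
    (h : 1 - y ≤ ν) : shiftRate c ν y ≤ tiltRate c (c / ν) y := by
  have ha : 0 < c / ν := by positivity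
  have hp : 0 < 1 - Real.exp (-(c / ν)) := by
    rw [sub_pos, Real.exp_lt_one_iff]; linarith
  have h1 := mul_log_div_le (sub_nonneg.2 hy) (mul_pos hν hp)
  have h2 := mul_log_div_le (sub_nonneg.2 h) (mul_pos hν (Real.exp_pos (-(c / ν))))
  rw [Real.log_mul hν.ne' hp.ne', log_one_sub_exp_neg ha] at h1
  rw [Real.log_mul hν.ne' (Real.exp_ne_zero _), Real.log_exp] at h2
  have h3 : ν * (c / ν) = c := by field_simp
  unfold shiftRate tiltRate
  rw [Real.log_div hc.ne' hν.ne']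
  have h4 := add_le_add h1 h2
  have h5 : (1 - y) * (c / ν) + (ν - (1 - y)) * (c / ν) = c := by
    linear_combination h3
  linarith

theorem shiftRate_one (c y : ℝ) : shiftRate c 1 y = 0 := by
  simp [shiftRate]

/-- The value of `detachedRate` between the threshold `1 - c` and `1`. -/
theorem detachedRate_eq_tiltRate {c a y : ℝ} (hc : 0 < c) (ha : 0 < a) (h1 : 1 - c < y)
    (h2 : y < 1) : detachedRate c a y = (tiltRate c a y : ℝ) := by
  have h3 : ¬(y < 1 - c ∨ y = 1) := by
    rintro (h | h) <;> linarith
  rw [detachedRate, if_neg h3, if_neg h1.ne']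
  congr 1
  have hca : 0 < Real.exp c - 1 := by linarith [Real.add_one_lt_exp hc.ne']
  have haa : 0 < Real.exp a - 1 := by linarith [Real.add_one_lt_exp ha.ne']
  have hcp : 0 < 1 - Real.exp (-c) := by
    rw [sub_pos, Real.exp_lt_one_iff]; linarith
  have hy : y * Real.log (y / Real.exp (-c)) = y * Real.log y + y * c := by
    rcases eq_or_ne y 0 with rfl | hy
    · simp
    · rw [Real.log_div hy (Real.exp_ne_zero _), Real.log_exp]; ring
  rw [hy, Real.log_div (by linarith) hcp.ne', Real.log_div ha.ne' hc.ne',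
    Real.log_div hca.ne' haa.ne', log_one_sub_exp_neg hc, tiltRate]
  ring

theorem one_sub_lt_div_of_eq {c y a : ℝ} (hc : 0 < c) (ha : 0 < a)
    (h : (1 - Real.exp (-a)) / a = (1 - y) / c) : 1 - y < c / a := by
  rw [div_eq_div_iff ha.ne' hc.ne'] at h
  rw [lt_div_iff₀ ha, ← h]
  nlinarith [Real.exp_pos (-a)]

/-- The equality case of Gibbs' inequality: the equation for `a` says that both splits of the mass
`ν = c / a` coincide. -/
theorem tiltRate_eq_shiftRate {c a y : ℝ} (hc : 0 < c) (ha : 0 < a)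
    (h : (1 - Real.exp (-a)) / a = (1 - y) / c) :
    tiltRate c a y = shiftRate c (c / a) y := by
  have hν : 0 < c / a := by positivity
  have hp : 0 < 1 - Real.exp (-a) := by
    rw [sub_pos, Real.exp_lt_one_iff]; linarith
  have hr : 1 - y = c / a * (1 - Real.exp (-a)) := by
    rw [div_eq_div_iff ha.ne' hc.ne'] at h
    field_simp
    linarith
  have h3 : c / a - (1 - y) = c / a * Real.exp (-a) := by rw [hr]; ring
  have h4 : Real.log (1 - y) = Real.log c - Real.log a + (Real.log (Real.exp a - 1) - a) := by
    rw [hr, Real.log_mul hν.ne' hp.ne', log_one_sub_exp_neg ha, Real.log_div hc.ne' ha.ne']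
  have h5 : Real.log (c / a - (1 - y)) = Real.log c - Real.log a - a := by
    rw [h3, Real.log_mul hν.ne' (Real.exp_ne_zero _), Real.log_exp,
      Real.log_div hc.ne' ha.ne']
    ring
  have h6 : c / a * a = c := by field_simp
  rw [tiltRate, shiftRate, h4, h5, Real.log_div hc.ne' ha.ne']
  linear_combination -h6

/-- Replaces the difference of the two large terms `ν log ν` and `(ν - (1 - y)) log (ν - (1 - y))`
by a bound whose behaviour as `ν → ∞` is visible; this is the regime for `y ≤ 1 - c`. -/
theorem le_shiftRate {c ν y : ℝ} (hν : 0 < ν) (h : 1 - y < ν) :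
    y * Real.log y + (1 - y) * Real.log (ν - (1 - y)) + (1 - y) - c * Real.log ν
      ≤ shiftRate c ν y := by
  have := mul_log_div_le hν.le (sub_pos.2 h)
  unfold shiftRate
  nlinarith

theorem tendsto_log_sub_log_sub (r : ℝ) :
    Tendsto (fun ν : ℝ => Real.log (ν - r) - Real.log ν) atTop (𝓝 0) := by
  have h1 : Tendsto (fun ν : ℝ => 1 - r / ν) atTop (𝓝 1) := by
    have h : Tendsto (fun ν : ℝ => r / ν) atTop (𝓝 0) := tendsto_const_nhds.div_atTop tendsto_id
    simpa using h.const_sub 1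
  have h2 := (Real.continuousAt_log one_ne_zero).tendsto.comp h1
  rw [Real.log_one] at h2
  refine h2.congr' ?_
  filter_upwards [eventually_gt_atTop 0, eventually_gt_atTop r] with ν h0 hr
  rw [← Real.log_div (by linarith) h0.ne']
  simp only [Function.comp]
  congr 1
  field_simp

/-- The optimal `ν` is `c / a` between the threshold and 1. At `y = 1` the supremum is approached as
`ν → 0`, and for `y ≤ 1 - c` as `ν → ∞`, where the coefficient `1 - y - c` of `log ν` is positive
below the threshold and zero at it. -/
theorem exists_lt_shiftRate {c a y L : ℝ} (hc : 0 < c) (hy0 : 0 ≤ y) (hy1 : y ≤ 1)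
    (ha : 1 - c < y → y < 1 → 0 < a ∧ (1 - Real.exp (-a)) / a = (1 - y) / c)
    (hL : (L : EReal) < detachedRate c a y) :
    ∃ ν, 0 < ν ∧ 1 - y < ν ∧ L < shiftRate c ν y := by
  rcases hy1.eq_or_lt with rfl | hy1'
  -- For `y = 1` the exponent is `-c * log ν`, which equals `L + 1` at this `ν`.
  · refine ⟨Real.exp (-(L + 1) / c), Real.exp_pos _, by simpa using Real.exp_pos _, ?_⟩
    have h1 : c * (-(L + 1) / c) = -(L + 1) := by field_simp
    rw [shiftRate, Real.log_exp, h1]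
    simp
  rcases lt_trichotomy y (1 - c) with h | h | h
  · have h1 : Tendsto (fun ν : ℝ => y * Real.log y + (1 - y) + ((1 - y) - c) * Real.log ν
        + (1 - y) * (Real.log (ν - (1 - y)) - Real.log ν)) atTop atTop := by
      refine Filter.Tendsto.atTop_add (C := (1 - y) * 0) ?_
        ((tendsto_log_sub_log_sub (1 - y)).const_mul _)
      exact tendsto_atTop_add_const_left _ _
        (Real.tendsto_log_atTop.const_mul_atTop (by linarith))
    obtain ⟨ν, hν, h0, hr⟩ := ((h1.eventually_gt_atTop L).and
      ((eventually_gt_atTop 0).and (eventually_gt_atTop (1 - y)))).exists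
    refine ⟨ν, h0, hr, hν.trans_le (le_trans (le_of_eq (by ring)) (le_shiftRate h0 hr))⟩
  · have hL' : L < y * Real.log y + c := by
      rw [detachedRate, if_neg (by rintro (h | h) <;> linarith), if_pos h] at hL
      exact_mod_cast hL
    have h1 : Tendsto (fun ν : ℝ => y * Real.log y + c
        + (1 - y) * (Real.log (ν - (1 - y)) - Real.log ν)) atTop
        (𝓝 (y * Real.log y + c + (1 - y) * 0)) :=
      ((tendsto_log_sub_log_sub (1 - y)).const_mul _).const_add _
    rw [mul_zero, add_zero] at h1
    obtain ⟨ν, hν, h0, hr⟩ := ((h1.eventually_const_lt hL').and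
      ((eventually_gt_atTop 0).and (eventually_gt_atTop (1 - y)))).exists
    refine ⟨ν, h0, hr, hν.trans_le (le_trans (le_of_eq ?_) (le_shiftRate h0 hr))⟩
    have : c = 1 - y := by linarith
    rw [this]; ring
  · obtain ⟨ha0, hae⟩ := ha h hy1'
    rw [detachedRate_eq_tiltRate hc ha0 h hy1', EReal.coe_lt_coe_iff,
      tiltRate_eq_shiftRate hc ha0 hae] at hL
    exact ⟨c / a, by positivity, one_sub_lt_div_of_eq hc ha0 hae, hL⟩

theorem tiltRate_le_detachedRate {c a b y : ℝ} (hc : 0 < c) (hb : 0 < b)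
    (ha : 1 - c < y → y < 1 → 0 < a ∧ (1 - Real.exp (-a)) / a = (1 - y) / c) (hy1 : y ≤ 1) :
    (tiltRate c b y : EReal) ≤ detachedRate c a y := by
  by_cases h1 : y < 1 - c ∨ y = 1
  · rw [detachedRate, if_pos h1]; exact le_top
  obtain ⟨h2, h3⟩ := not_or.1 h1
  have hy := lt_of_le_of_ne hy1 h3
  rcases (not_lt.1 h2).eq_or_lt with h | h
  · rw [detachedRate, if_neg h1, if_pos h.symm, EReal.coe_le_coe_iff, tiltRate]
    have hc' : c = 1 - y := by linarith
    have : Real.log b ≤ Real.log (Real.exp b - 1) :=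
      Real.log_le_log hb (by linarith [Real.add_one_le_exp b])
    rw [← hc']
    nlinarith
  · obtain ⟨ha0, hae⟩ := ha h hy
    rw [detachedRate_eq_tiltRate hc ha0 h hy, EReal.coe_le_coe_iff]
    exact tiltRate_le_of_eq hc ha0 hae hb

/-- The rate is the pointwise supremum of `tiltRate c b` over `b > 0`, including the infinite and
the threshold values. Lower semicontinuity and convexity both follow from this. -/
theorem lt_detachedRate_iff {c a y : ℝ} (hc : 0 < c) (hy0 : 0 ≤ y) (hy1 : y ≤ 1)
    (ha : 1 - c < y → y < 1 → 0 < a ∧ (1 - Real.exp (-a)) / a = (1 - y) / c) (L : EReal) :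
    L < detachedRate c a y ↔ ∃ b, 0 < b ∧ L < (tiltRate c b y : ℝ) := by
  constructor
  · intro hL
    induction L with
    | bot => exact ⟨1, one_pos, EReal.bot_lt_coe _⟩
    | top => exact absurd hL not_top_lt
    | coe L =>
      obtain ⟨ν, h0, h1, h2⟩ := exists_lt_shiftRate hc hy0 hy1 ha hL
      exact ⟨c / ν, by positivity,
        EReal.coe_lt_coe_iff.2 (h2.trans_le (shiftRate_le_tiltRate hc h0 hy1 h1.le))⟩
  · rintro ⟨b, hb, hL⟩
    exact hL.trans_le (tiltRate_le_detachedRate hc hb ha hy1)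

theorem detachedRate_le_iff {c a y : ℝ} (hc : 0 < c) (hy0 : 0 ≤ y) (hy1 : y ≤ 1)
    (ha : 1 - c < y → y < 1 → 0 < a ∧ (1 - Real.exp (-a)) / a = (1 - y) / c) (L : ℝ) :
    detachedRate c a y ≤ L ↔ ∀ b, 0 < b → tiltRate c b y ≤ L := by
  rw [← not_iff_not, not_le, lt_detachedRate_iff hc hy0 hy1 ha]
  push Not
  simp only [EReal.coe_lt_coe_iff]

theorem continuous_tiltRate (c b : ℝ) : Continuous (tiltRate c b) := by
  have h1 : Continuous fun y : ℝ => y * Real.log y := Real.continuous_mul_log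
  have h2 : Continuous fun y : ℝ => (1 - y) * Real.log (1 - y) :=
    Real.continuous_mul_log.comp (continuous_const.sub continuous_id)
  unfold tiltRate
  fun_prop

theorem convexOn_tiltRate (c b : ℝ) : ConvexOn ℝ (Set.Icc 0 1) (tiltRate c b) := by
  have h1 : ConvexOn ℝ (Set.Icc (0 : ℝ) 1) fun y => y * Real.log y :=
    Real.convexOn_mul_log.subset (fun y hy => hy.1) (convex_Icc 0 1)
  refine ⟨convex_Icc 0 1, fun x hx y hy s t hs ht hst => ?_⟩
  have h2 := h1.2 hx hy hs ht hst
  have h3 := h1.2 (x := 1 - x) (y := 1 - y) ⟨by linarith [hx.2], by linarith [hx.1]⟩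
    ⟨by linarith [hy.2], by linarith [hy.1]⟩ hs ht hst
  have h4 : s • (1 - x) + t • (1 - y) = 1 - (s • x + t • y) := by
    simp only [smul_eq_mul]; linear_combination hst
  rw [h4] at h3
  simp only [smul_eq_mul] at h2 h3 ⊢
  unfold tiltRate
  have ht' : t = 1 - s := by linarith
  subst ht'
  linarith

/-! ### The rate function is good and convex. -/

section RateFunction

variable {c : ℝ} {α : ℝ → ℝ}

theorem isGoodRateFunction_detachedRate (hc : 0 < c)
    (hα : ∀ y, 0 ≤ y → 1 - c < y → y < 1 →
      0 < α y ∧ (1 - Real.exp (-α y)) / α y = (1 - y) / c) :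
    IsGoodRateFunction (fun y : I => detachedRate c (α y) y) := by
  have hlsc : LowerSemicontinuous (fun y : I => detachedRate c (α y) y) := by
    intro y L hL
    obtain ⟨b, hb, h⟩ := (lt_detachedRate_iff hc y.2.1 y.2.2 (hα y y.2.1) L).1 hL
    have hcont : Continuous fun y : I => ((tiltRate c b y : ℝ) : EReal) :=
      continuous_coe_real_ereal.comp ((continuous_tiltRate c b).comp continuous_subtype_val)
    filter_upwards [hcont.continuousAt.eventually_const_lt h] with z hz
    exact (lt_detachedRate_iff hc z.2.1 z.2.2 (hα z z.2.1) L).2 ⟨b, hb, hz⟩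
  refine ⟨fun y => ?_, hlsc, fun L => (hlsc.isClosed_preimage (L : EReal)).isCompact⟩
  -- The parameter `b = c` corresponds to `ν = 1`, that is, to no change of the number of nodes,
  -- where `shiftRate` vanishes.
  refine le_trans ?_ (tiltRate_le_detachedRate hc hc (hα y y.2.1) y.2.2)
  have h := shiftRate_le_tiltRate (y := y) hc one_pos y.2.2 (by linarith [y.2.1])
  rw [shiftRate_one, div_one] at h
  exact_mod_cast h

theorem isConvexOnUnitInterval_detachedRate (hc : 0 < c)
    (hα : ∀ y, 0 ≤ y → 1 - c < y → y < 1 →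
      0 < α y ∧ (1 - Real.exp (-α y)) / α y = (1 - y) / c) :
    IsConvexOnUnitInterval (fun y : I => detachedRate c (α y) y) := by
  rintro ⟨_, p⟩ ⟨x, rfl, hx⟩ ⟨_, q⟩ ⟨y, rfl, hy⟩ s t hs ht hst
  have hmem := convex_Icc (0 : ℝ) 1 x.2 y.2 hs ht hst
  refine ⟨⟨_, hmem⟩, rfl, ?_⟩
  rw [detachedRate_le_iff hc hmem.1 hmem.2 (hα _ hmem.1)]
  intro b hb
  have h1 := (detachedRate_le_iff hc x.2.1 x.2.2 (hα x x.2.1) p).1 hx b hb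
  have h2 := (detachedRate_le_iff hc y.2.1 y.2.2 (hα y y.2.1) q).1 hy b hb
  refine ((convexOn_tiltRate c b).2 x.2 y.2 hs ht hst).trans ?_
  simp only [Prod.smul_mk, Prod.mk_add_mk]
  gcongr

end RateFunction

/-! ### Asymptotics of factorials and binomial coefficients. -/

theorem abs_log_factorial_sub_le (n : ℕ) :
    |Real.log n.factorial - (n * Real.log n - n)| ≤ 1 + Real.log (n + 1) := by
  rcases Nat.eq_zero_or_pos n with rfl | hn
  · simp
  have hup : Real.log n.factorial ≤ n * Real.log n - n + 1 + Real.log n := by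
    induction n, hn using Nat.le_induction with
    | base => simp
    | succ n hn ih =>
      have h0 : (0 : ℝ) < n := by exact_mod_cast hn
      rw [Nat.factorial_succ, Nat.cast_mul, Real.log_mul (by positivity) (by positivity)]
      have h1 := Real.one_sub_inv_le_log_of_pos (x := ((n : ℝ) + 1) / n) (by positivity)
      rw [Real.log_div (by positivity) h0.ne', inv_div] at h1
      have h2 : ((n : ℝ) + 1) * (1 - n / (n + 1)) = 1 := by field_simp; ring
      have h3 : 1 ≤ ((n : ℝ) + 1) * (Real.log (n + 1) - Real.log n) := by
        have := mul_le_mul_of_nonneg_left h1 (show 0 ≤ (n : ℝ) + 1 by positivity)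
        rwa [h2] at this
      push_cast
      linarith
  have hlow := Stirling.le_log_factorial_stirling hn.ne'
  have h0 : (1 : ℝ) ≤ n := by exact_mod_cast hn
  have h1 : 0 ≤ Real.log n := Real.log_nonneg h0
  have h2 : 0 ≤ Real.log (2 * Real.pi) := Real.log_nonneg (by linarith [Real.pi_gt_three])
  have h3 : Real.log n ≤ Real.log (n + 1) := Real.log_le_log (by linarith) (by linarith)
  rw [abs_le]
  constructor <;> linarith

theorem log_choose {n j : ℕ} (h : j ≤ n) :
    Real.log (n.choose j) = Real.log n.factorial - Real.log j.factorial
      - Real.log (n - j).factorial := by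
  rw [Nat.cast_choose ℝ h, Real.log_div (by positivity) (by positivity),
    Real.log_mul (by positivity) (by positivity)]
  ring

/-- The factor `j!` cancels in the quotient and so do the linear terms of Stirling's formula; one
logarithmic error remains for each of the four other factorials. -/
theorem abs_log_choose_sub_log_choose_le {n N j : ℕ} (hn : j ≤ n) (hN : j ≤ N) :
    |Real.log (n.choose j) - Real.log (N.choose j)
      - (n * Real.log n - ((n : ℝ) - j) * Real.log ((n : ℝ) - j) - N * Real.log N
        + ((N : ℝ) - j) * Real.log ((N : ℝ) - j))| ≤ 4 * (1 + Real.log ((n : ℝ) + N + 1)) := by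
  have key : ∀ k : ℕ, k ≤ n + N → |Real.log k.factorial - (k * Real.log k - k)|
      ≤ 1 + Real.log ((n : ℝ) + N + 1) := by
    intro k hk
    refine (abs_log_factorial_sub_le k).trans ?_
    have : (k : ℝ) ≤ n + N := by exact_mod_cast hk
    gcongr
  have h1 := abs_le.1 (key n (by omega))
  have h2 := abs_le.1 (key N (by omega))
  have h3 := abs_le.1 (key (n - j) (by omega))
  have h4 := abs_le.1 (key (N - j) (by omega))
  rw [Nat.cast_sub hn] at h3
  rw [Nat.cast_sub hN] at h4
  rw [log_choose hn, log_choose hN, abs_le]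
  constructor <;> linarith [h1.1, h1.2, h2.1, h2.2, h3.1, h3.2, h4.1, h4.2]

theorem mul_log_mul {n : ℝ} (hn : 0 < n) (z : ℝ) :
    n * z * Real.log (n * z) = n * (z * Real.log z) + n * z * Real.log n := by
  rcases eq_or_ne z 0 with rfl | hz
  · simp
  · rw [Real.log_mul hn.ne' hz]; ring

section Sequences

variable {N m : ℕ → ℕ} {ν μ κ : ℝ}

theorem tendsto_choose_two_div (hN : Tendsto (fun n : ℕ => (N n : ℝ) / n) atTop (𝓝 ν)) :
    Tendsto (fun n : ℕ => ((N n).choose 2 : ℝ) / (n : ℝ) ^ 2) atTop (𝓝 (ν ^ 2 / 2)) := by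
  have h1 : Tendsto (fun n : ℕ => (1 : ℝ) / n) atTop (𝓝 0) := tendsto_one_div_atTop_nhds_zero_nat
  have h2 := (hN.mul (hN.sub h1)).div_const 2
  rw [sub_zero, ← pow_two] at h2
  refine h2.congr fun n => ?_
  rw [Nat.cast_choose_two]
  rcases eq_or_ne (n : ℝ) 0 with h | h
  · simp [h]
  · field_simp

theorem eventually_lt_of_tendsto_div (hm : Tendsto (fun n : ℕ => (m n : ℝ) / n) atTop (𝓝 μ))
    {M : ℕ → ℕ} (hM : Tendsto (fun n : ℕ => (M n : ℝ) / (n : ℝ) ^ 2) atTop (𝓝 κ)) (hκ : 0 < κ) :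
    ∀ᶠ n in atTop, m n < M n := by
  have h1 : Tendsto (fun n : ℕ => (1 : ℝ) / n) atTop (𝓝 0) := tendsto_one_div_atTop_nhds_zero_nat
  have h2 := hm.mul h1
  rw [mul_zero] at h2
  filter_upwards [h2.eventually_lt hM hκ, eventually_gt_atTop 0] with n hn h0
  have h0' : (0 : ℝ) < n := by exact_mod_cast h0
  rw [div_mul_div_comm, mul_one, ← pow_two, div_lt_div_iff_of_pos_right (by positivity)] at hn
  exact_mod_cast hn

/-- Up to `m!` the binomial coefficient is a falling factorial between `(M - m) ^ m` and `M ^ m`.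
Since `M` is of order `n²` and `m` of order `n`, both have the same exponent. -/
theorem tendsto_log_choose_div (hm : Tendsto (fun n : ℕ => (m n : ℝ) / n) atTop (𝓝 μ))
    {M : ℕ → ℕ} (hM : Tendsto (fun n : ℕ => (M n : ℝ) / (n : ℝ) ^ 2) atTop (𝓝 κ)) (hκ : 0 < κ) :
    Tendsto (fun n : ℕ => (Real.log ((M n).choose (m n)) + Real.log (m n).factorial
      - m n * Real.log ((n : ℝ) ^ 2)) / n) atTop (𝓝 (μ * Real.log κ)) := by
  have h1 : Tendsto (fun n : ℕ => (1 : ℝ) / n) atTop (𝓝 0) := tendsto_one_div_atTop_nhds_zero_nat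
  have hlow : Tendsto (fun n : ℕ => (M n : ℝ) / (n : ℝ) ^ 2 - (m n : ℝ) / n * (1 / n))
      atTop (𝓝 κ) := by
    simpa using hM.sub (hm.mul h1)
  have hA := hm.mul (hlow.log hκ.ne')
  have hB := hm.mul (hM.log hκ.ne')
  refine tendsto_of_tendsto_of_tendsto_of_le_of_le' hA hB ?_ ?_
  all_goals
    filter_upwards [eventually_lt_of_tendsto_div hm hM hκ, eventually_gt_atTop 0] with n hn h0
    have h0' : (0 : ℝ) < n := by exact_mod_cast h0
    have hn' : (m n : ℝ) < M n := by exact_mod_cast hn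
    have hc : Real.log ((M n).choose (m n)) + Real.log (m n).factorial
        = Real.log ((M n).descFactorial (m n)) := by
      rw [Nat.descFactorial_eq_factorial_mul_choose, Nat.cast_mul,
        Real.log_mul (by positivity)
          (by exact_mod_cast (Nat.choose_pos hn.le).ne'), add_comm]
    have hdpos : (0 : ℝ) < (M n).descFactorial (m n) := by
      exact_mod_cast Nat.descFactorial_pos.2 hn.le
    have hMpos : (0 : ℝ) < M n := (Nat.cast_nonneg _).trans_lt hn'
    rw [hc, div_mul_eq_mul_div, div_le_div_iff_of_pos_right h0']
  · have h2 : (M n : ℝ) / (n : ℝ) ^ 2 - (m n : ℝ) / n * (1 / n) = (M n - m n) / (n : ℝ) ^ 2 := by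
      field_simp
    rw [h2, Real.log_div (by linarith) (by positivity), mul_sub]
    refine sub_le_sub_right ?_ _
    rw [← Real.log_pow]
    refine Real.log_le_log (pow_pos (by linarith) _) ?_
    have h3 : ((M n + 1 - m n : ℕ) : ℝ) ^ m n ≤ (M n).descFactorial (m n) := by
      exact_mod_cast Nat.pow_sub_le_descFactorial (M n) (m n)
    refine le_trans (pow_le_pow_left₀ (by linarith) ?_ _) h3
    rw [Nat.cast_sub (by omega)]
    push_cast
    linarith
  · rw [Real.log_div hMpos.ne' (by positivity), mul_sub]
    refine sub_le_sub_right ?_ _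
    rw [← Real.log_pow]
    refine Real.log_le_log hdpos ?_
    exact_mod_cast Nat.descFactorial_le_pow (M n) (m n)

theorem tendsto_log_choose_sub_log_choose
    (hm : Tendsto (fun n : ℕ => (m n : ℝ) / n) atTop (𝓝 μ))
    (hN : Tendsto (fun n : ℕ => (N n : ℝ) / n) atTop (𝓝 ν)) (hν : 0 < ν) :
    Tendsto (fun n : ℕ => (Real.log (((N n).choose 2).choose (m n))
      - Real.log ((n.choose 2).choose (m n))) / n) atTop (𝓝 (2 * μ * Real.log ν)) := by
  have h1 : Tendsto (fun n : ℕ => (n : ℝ) / n) atTop (𝓝 1) := by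
    refine tendsto_const_nhds.congr' ?_
    filter_upwards [eventually_gt_atTop 0] with n hn
    rw [div_self (by positivity)]
  have h2 := (tendsto_log_choose_div hm (tendsto_choose_two_div hN) (by positivity)).sub
    (tendsto_log_choose_div hm (tendsto_choose_two_div h1) (by positivity))
  have h3 : μ * Real.log (ν ^ 2 / 2) - μ * Real.log (1 ^ 2 / 2) = 2 * μ * Real.log ν := by
    rw [Real.log_div (by positivity) (by norm_num), Real.log_div (by norm_num) (by norm_num),
      Real.log_pow]
    simp
    ring
  rw [h3] at h2
  refine h2.congr fun n => ?_
  ring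

theorem tendsto_ceil_mul_div (hν : 0 < ν) :
    Tendsto (fun n : ℕ => ((⌈ν * n⌉₊ : ℕ) : ℝ) / n) atTop (𝓝 ν) :=
  (tendsto_nat_ceil_mul_div_atTop hν.le).comp tendsto_natCast_atTop_atTop

theorem tendsto_log_add_div (hN : Tendsto (fun n : ℕ => (N n : ℝ) / n) atTop (𝓝 ν)) (hν : 0 < ν) :
    Tendsto (fun n : ℕ => 4 * (1 + Real.log ((n : ℝ) + N n + 1)) / n) atTop (𝓝 0) := by
  have h1 : Tendsto (fun n : ℕ => (1 : ℝ) / n) atTop (𝓝 0) := tendsto_one_div_atTop_nhds_zero_nat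
  have h2 : Tendsto (fun n : ℕ => 1 + (N n : ℝ) / n + 1 / n) atTop (𝓝 (1 + ν + 0)) :=
    (hN.const_add 1).add h1
  have h3 : Tendsto (fun n : ℕ => Real.log n / n) atTop (𝓝 0) :=
    (Real.isLittleO_log_id_atTop.tendsto_div_nhds_zero).comp tendsto_natCast_atTop_atTop
  have h4 := (((h1.add h3).add ((h2.log (by linarith)).mul h1))).const_mul 4
  simp only [add_zero, mul_zero] at h4
  refine h4.congr' ?_
  filter_upwards [eventually_gt_atTop 0] with n hn
  have hn' : (0 : ℝ) < n := by exact_mod_cast hn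
  have h5 : (n : ℝ) + N n + 1 = n * (1 + (N n : ℝ) / n + 1 / n) := by field_simp
  rw [h5, Real.log_mul hn'.ne' (by positivity)]
  ring

/-- The cost of passing from `n` to `ν * n` nodes, uniformly in the number of nodes that are not
detached. -/
theorem eventually_abs_log_choose_add_shiftRate_le {c : ℝ}
    (hm : Tendsto (fun n : ℕ => (m n : ℝ) / n) atTop (𝓝 (c / 2))) (hν : 0 < ν) {ε : ℝ}
    (hε : 0 < ε) :
    ∀ᶠ n : ℕ in atTop, ∀ j : ℕ, j ≤ n → (j : ℝ) ≤ ν * n →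
      |Real.log (n.choose j) - Real.log (⌈ν * n⌉₊.choose j)
        + (Real.log ((⌈ν * n⌉₊.choose 2).choose (m n)) - Real.log ((n.choose 2).choose (m n)))
        + n * shiftRate c ν (1 - j / n)| ≤ ε * n := by
  have hN := tendsto_ceil_mul_div hν
  have hT := tendsto_log_choose_sub_log_choose hm hN hν
  have hη : Tendsto (fun n : ℕ => ((⌈ν * n⌉₊ : ℕ) : ℝ) / n * Real.log (((⌈ν * n⌉₊ : ℕ) : ℝ) / n))
      atTop (𝓝 (ν * Real.log ν)) := (Real.continuous_mul_log.tendsto ν).comp hN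
  have huc := (isCompact_Icc (a := (0 : ℝ)) (b := ν + 1)).uniformContinuousOn_of_continuous
    Real.continuous_mul_log.continuousOn
  -- The bound has to be uniform in `j`, and `ν - j/n` may be arbitrarily close to 0; uniform
  -- continuity of `x log x` down to 0 handles the rounding of `ν * n`.
  obtain ⟨δ, hδ, hunif⟩ := Metric.uniformContinuousOn_iff.1 huc (ε / 4) (by positivity)
  rw [show 2 * (c / 2) * Real.log ν = c * Real.log ν by ring] at hT
  filter_upwards [(tendsto_log_add_div hN hν).eventually_lt_const (show 0 < ε / 4 by positivity),
    Metric.tendsto_nhds.1 hT (ε / 4) (by positivity),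
    Metric.tendsto_nhds.1 hη (ε / 4) (by positivity),
    Metric.tendsto_nhds.1 hN (min δ 1) (by positivity), eventually_gt_atTop 0]
    with n h1 h2 h3 h4 h0 j hjn hjν
  have hn : (0 : ℝ) < n := by exact_mod_cast h0
  set K := ⌈ν * n⌉₊ with hK
  have hjK : j ≤ K := by exact_mod_cast hjν.trans (Nat.le_ceil _)
  have hjK' : (j : ℝ) ≤ K := by exact_mod_cast hjK
  have h5 := abs_log_choose_sub_log_choose_le hjn hjK
  have hx : (j : ℝ) / n ≤ ν := by rwa [div_le_iff₀ hn]
  have hx0 : 0 ≤ (j : ℝ) / n := by positivity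
  have hxK : (j : ℝ) / n ≤ K / n := by gcongr
  have h6 := hunif (K / n - j / n) ⟨by linarith, by
    rw [Real.dist_eq] at h4
    have := (abs_lt.1 h4).2
    linarith [min_le_right δ 1]⟩ (ν - j / n) ⟨by linarith, by linarith⟩ (by
      rw [Real.dist_eq] at h4 ⊢
      rw [sub_sub_sub_cancel_right]
      exact h4.trans_le (min_le_left _ _))
  -- After rescaling by `n` the coefficients of `log n` add up to `n - (n - j) - K + (K - j) = 0`.
  have e1 := mul_log_mul hn 1
  have e2 := mul_log_mul hn (1 - j / n)
  have e3 := mul_log_mul hn (K / n)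
  have e4 := mul_log_mul hn (K / n - j / n)
  rw [show (n : ℝ) * (1 - j / n) = n - j by field_simp] at e2
  rw [show (n : ℝ) * (K / n) = K by field_simp] at e3
  rw [show (n : ℝ) * (K / n - j / n) = K - j by field_simp] at e4
  rw [mul_one, Real.log_one, mul_zero, mul_zero, zero_add] at e1
  rw [div_lt_iff₀ hn] at h1
  rw [Real.dist_eq] at h2 h3 h6
  have h2' : |(Real.log ((K.choose 2).choose (m n)) - Real.log ((n.choose 2).choose (m n)))
      - n * (c * Real.log ν)| ≤ ε / 4 * n := by
    have := mul_le_mul_of_nonneg_right h2.le hn.le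
    rw [← abs_of_pos hn, ← abs_mul, abs_of_pos hn, sub_mul, div_mul_cancel₀ _ hn.ne'] at this
    rwa [mul_comm (n : ℝ)]
  have h3' : |n * (K / n * Real.log (K / n)) - n * (ν * Real.log ν)| ≤ ε / 4 * n := by
    rw [← mul_sub, abs_mul, abs_of_pos hn, mul_comm]
    gcongr
  have h6' : |n * ((K / n - j / n) * Real.log (K / n - j / n))
      - n * ((ν - j / n) * Real.log (ν - j / n))| ≤ ε / 4 * n := by
    rw [← mul_sub, abs_mul, abs_of_pos hn, mul_comm]
    gcongr
  have h7 : (n : ℝ) * shiftRate c ν (1 - j / n) = n * ((1 - j / n) * Real.log (1 - j / n))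
      + n * (ν * Real.log ν) - n * ((ν - j / n) * Real.log (ν - j / n))
      - n * (c * Real.log ν) := by
    rw [shiftRate, sub_sub_cancel]; ring
  rw [e2, e3, e4] at h5
  rw [h7]
  rw [abs_le] at h5 h2' h3' h6' ⊢
  constructor <;> linarith [h5.1, h5.2, h2'.1, h2'.2, h3'.1, h3'.2, h6'.1, h6'.2]

end Sequences

/-! ### Concentration of the number of detached nodes. -/

/-- Factor by factor: `(a - i) / (b - i)` decreases in `i`, hence is at most `a / b`. The next lemma
uses its lower bound `(a - m) / (b - m)`. -/
theorem descFactorial_mul_pow_le {a b : ℕ} (hab : a ≤ b) (m : ℕ) :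
    a.descFactorial m * b ^ m ≤ b.descFactorial m * a ^ m := by
  simp only [Nat.descFactorial_eq_prod_range]
  conv_lhs => rw [← Finset.card_range m, ← Finset.prod_const, Finset.card_range]
  conv_rhs => rw [← Finset.card_range m, ← Finset.prod_const, Finset.card_range]
  rw [← Finset.prod_mul_distrib, ← Finset.prod_mul_distrib]
  refine Finset.prod_le_prod' fun i _ => ?_
  rw [Nat.sub_mul, Nat.sub_mul, mul_comm b a]
  exact Nat.sub_le_sub_left (Nat.mul_le_mul_left i hab) _

theorem descFactorial_mul_pow_sub_le {a b m : ℕ} (hma : m ≤ a) (hab : a ≤ b) :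
    b.descFactorial m * (a - m) ^ m ≤ a.descFactorial m * (b - m) ^ m := by
  simp only [Nat.descFactorial_eq_prod_range]
  conv_lhs => rw [← Finset.card_range m, ← Finset.prod_const, Finset.card_range]
  conv_rhs => rw [← Finset.card_range m, ← Finset.prod_const, Finset.card_range]
  rw [← Finset.prod_mul_distrib, ← Finset.prod_mul_distrib]
  refine Finset.prod_le_prod' fun i hi => ?_
  have hi := Finset.mem_range.1 hi
  obtain ⟨k, rfl⟩ := Nat.exists_eq_add_of_le hma
  obtain ⟨l, rfl⟩ := Nat.exists_eq_add_of_le hab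
  obtain ⟨p, rfl⟩ := Nat.exists_eq_add_of_lt hi
  rw [show i + p + 1 + k + l - i = p + 1 + k + l by omega,
    show i + p + 1 + k - (i + p + 1) = k by omega,
    show i + p + 1 + k - i = p + 1 + k by omega,
    show i + p + 1 + k + l - (i + p + 1) = k + l by omega]
  nlinarith

theorem choose_div_choose_le {a b m : ℕ} (hma : m < a) (hab : a ≤ b) :
    (a.choose m : ℝ) / b.choose m ≤ Real.exp (-(m * ((b : ℝ) - a) / b)) := by
  have hb : (0 : ℝ) < b := by exact_mod_cast (show 0 < b by omega)
  have hcb : (0 : ℝ) < b.choose m := by exact_mod_cast Nat.choose_pos (by omega)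
  have h1 : (a.choose m : ℝ) * b ^ m ≤ b.choose m * a ^ m := by
    have := descFactorial_mul_pow_le hab m
    rw [Nat.descFactorial_eq_factorial_mul_choose, Nat.descFactorial_eq_factorial_mul_choose,
      mul_assoc, mul_assoc] at this
    exact_mod_cast Nat.le_of_mul_le_mul_left this (Nat.factorial_pos m)
  have h2 : (a.choose m : ℝ) / b.choose m ≤ ((a : ℝ) / b) ^ m := by
    rw [div_pow, div_le_div_iff₀ hcb (by positivity)]
    linarith
  refine h2.trans ?_
  have h3 : (a : ℝ) / b ≤ Real.exp (-(((b : ℝ) - a) / b)) := by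
    refine le_trans (le_of_eq ?_) (Real.add_one_le_exp _)
    field_simp
    ring
  calc ((a : ℝ) / b) ^ m ≤ Real.exp (-(((b : ℝ) - a) / b)) ^ m := by gcongr
    _ = _ := by rw [← Real.exp_nat_mul]; congr 1; ring

theorem le_choose_div_choose {a b m : ℕ} (hma : m < a) (hab : a ≤ b) :
    Real.exp (-(m * ((b : ℝ) - a) / (a - m))) ≤ (a.choose m : ℝ) / b.choose m := by
  have hma' : (m : ℝ) < a := by exact_mod_cast hma
  have hab' : (a : ℝ) ≤ b := by exact_mod_cast hab
  have ha : (0 : ℝ) < a - m := by linarith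
  have hb : (0 : ℝ) < b - m := by linarith
  have hcb : (0 : ℝ) < b.choose m := by exact_mod_cast Nat.choose_pos (by omega)
  have h1 : (b.choose m : ℝ) * (a - m) ^ m ≤ a.choose m * (b - m) ^ m := by
    have := descFactorial_mul_pow_sub_le hma.le hab
    rw [Nat.descFactorial_eq_factorial_mul_choose, Nat.descFactorial_eq_factorial_mul_choose,
      mul_assoc, mul_assoc] at this
    rw [← Nat.cast_sub hma.le, ← Nat.cast_sub (hma.le.trans hab)]
    exact_mod_cast Nat.le_of_mul_le_mul_left this (Nat.factorial_pos m)
  have h2 : (((a : ℝ) - m) / (b - m)) ^ m ≤ (a.choose m : ℝ) / b.choose m := by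
    rw [div_pow, div_le_div_iff₀ (by positivity) hcb]
    linarith
  refine le_trans ?_ h2
  have h3 : Real.exp (-(((b : ℝ) - a) / (a - m))) ≤ ((a : ℝ) - m) / (b - m) := by
    rw [Real.exp_neg, inv_le_comm₀ (Real.exp_pos _) (by positivity), inv_div]
    refine le_trans (le_of_eq ?_) (Real.add_one_le_exp _)
    field_simp
    ring
  calc Real.exp (-(m * ((b : ℝ) - a) / (a - m)))
      = Real.exp (-(((b : ℝ) - a) / (a - m))) ^ m := by
        rw [← Real.exp_nat_mul]; congr 1; ring
    _ ≤ _ := by gcongr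

section Concentration

variable {N m : ℕ → ℕ} {ν c : ℝ}

/-- The quotient is the probability that `s` given nodes are all detached. They meet about `s * ν *
n` of the `(ν * n)² / 2` pairs of nodes, and each of the `c * n / 2` edges has to avoid these pairs.
-/
theorem tendsto_choose_sub_div_choose
    (hm : Tendsto (fun n : ℕ => (m n : ℝ) / n) atTop (𝓝 (c / 2)))
    (hN : Tendsto (fun n : ℕ => (N n : ℝ) / n) atTop (𝓝 ν)) (hν : 0 < ν) (s : ℕ) :
    Tendsto (fun n : ℕ => (((N n - s).choose 2).choose (m n) : ℝ)
      / (((N n).choose 2).choose (m n) : ℝ)) atTop (𝓝 (Real.exp (-(s * (c / ν))))) := by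
  have hinv : Tendsto (fun n : ℕ => (1 : ℝ) / n) atTop (𝓝 0) :=
    tendsto_one_div_atTop_nhds_zero_nat
  have hNtop : Tendsto (fun n : ℕ => (N n : ℝ)) atTop atTop := by
    have := hN.pos_mul_atTop hν tendsto_natCast_atTop_atTop
    refine this.congr' ?_
    filter_upwards [eventually_gt_atTop 0] with n hn
    rw [div_mul_cancel₀ _ (by positivity)]
  have hNs : ∀ᶠ n in atTop, s ≤ N n :=
    (hNtop.eventually_ge_atTop (s : ℝ)).mono fun n hn => by exact_mod_cast hn
  have hsub : Tendsto (fun n : ℕ => ((N n - s : ℕ) : ℝ) / n) atTop (𝓝 ν) := by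
    have h := hN.sub (hinv.const_mul (s : ℝ))
    rw [mul_zero, sub_zero] at h
    refine h.congr' ?_
    filter_upwards [hNs] with n hn
    rw [Nat.cast_sub hn]
    ring
  have hM := tendsto_choose_two_div hN
  have hMs := tendsto_choose_two_div hsub
  have hΔ : Tendsto (fun n : ℕ => (((N n).choose 2 : ℝ) - ((N n - s).choose 2 : ℝ)) / n) atTop
      (𝓝 (s * ν)) := by
    -- Exactly `s * N - s * (s + 1) / 2` pairs meet `s` given nodes.
    have h := (hN.const_mul (s : ℝ)).sub (hinv.const_mul ((s : ℝ) * (s + 1) / 2))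
    rw [mul_zero, sub_zero] at h
    refine h.congr' ?_
    filter_upwards [hNs] with n hn
    rw [Nat.cast_choose_two, Nat.cast_choose_two, Nat.cast_sub hn]
    ring
  have hlim : c / 2 * (s * ν) / (ν ^ 2 / 2) = s * (c / ν) := by field_simp
  have hup := (((hm.mul hΔ).div hM (by positivity)).neg).rexp
  have hlow' : Tendsto (fun n : ℕ => ((N n - s).choose 2 : ℝ) / (n : ℝ) ^ 2
      - (m n : ℝ) / n * (1 / n)) atTop (𝓝 (ν ^ 2 / 2)) := by
    simpa using hMs.sub (hm.mul hinv)
  have hlow := (((hm.mul hΔ).div hlow' (by positivity)).neg).rexp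
  rw [hlim] at hup hlow
  refine tendsto_of_tendsto_of_tendsto_of_le_of_le' hlow hup ?_ ?_
  all_goals
    filter_upwards [eventually_lt_of_tendsto_div hm hMs (by positivity), eventually_gt_atTop 0]
      with n hn h0
    have h0' : (n : ℝ) ≠ 0 := by positivity
    have hle : (N n - s).choose 2 ≤ (N n).choose 2 := Nat.choose_le_choose 2 (Nat.sub_le _ _)
  · refine le_trans (le_of_eq ?_) (le_choose_div_choose hn hle)
    simp only [Pi.div_apply]
    congr 2
    have hpos : ((N n - s).choose 2 : ℝ) - m n ≠ 0 := by
      have : (m n : ℝ) < (N n - s).choose 2 := by exact_mod_cast hn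
      linarith
    have h4 : ((N n - s).choose 2 : ℝ) / (n : ℝ) ^ 2 - (m n : ℝ) / n * (1 / n)
        = (((N n - s).choose 2 : ℝ) - m n) / (n : ℝ) ^ 2 := by field_simp
    rw [h4]
    field_simp
  · refine (choose_div_choose_le hn hle).trans (le_of_eq ?_)
    simp only [Pi.div_apply]
    congr 2
    have hpos : ((N n).choose 2 : ℝ) ≠ 0 := by
      have : 0 < (N n).choose 2 := by omega
      positivity
    field_simp

/-- The first factorial moment of the number of detached nodes. The identity `(k+1-j) C(k+1,j) =
(k+1) C(k,j)` reduces it to the count of all graphs on one node fewer. -/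
theorem sum_sub_mul_choose_mul_spanningCount (k m : ℕ) :
    ∑ j ∈ Finset.range (k + 2), (k + 1 - j) * ((k + 1).choose j * spanningCount j m)
      = (k + 1) * (k.choose 2).choose m := by
  rw [Finset.sum_range_succ, Nat.sub_self, zero_mul, add_zero,
    ← sum_choose_mul_spanningCount, Finset.mul_sum]
  refine Finset.sum_congr rfl fun j _ => ?_
  rw [← mul_assoc, ← mul_assoc, mul_comm (k + 1 - j), ← Nat.choose_mul_succ_eq,
    mul_comm (k.choose j)]

theorem sum_sub_mul_sub_mul_choose_mul_spanningCount (k m : ℕ) :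
    ∑ j ∈ Finset.range (k + 3),
      (k + 2 - j) * ((k + 1 - j) * ((k + 2).choose j * spanningCount j m))
      = (k + 2) * ((k + 1) * (k.choose 2).choose m) := by
  rw [Finset.sum_range_succ, Nat.sub_self, zero_mul, add_zero,
    ← sum_sub_mul_choose_mul_spanningCount, Finset.mul_sum]
  refine Finset.sum_congr rfl fun j _ => ?_
  have h := Nat.choose_mul_succ_eq (k + 1) j
  calc (k + 2 - j) * ((k + 1 - j) * ((k + 2).choose j * spanningCount j m))
      = ((k + 1 + 1).choose j * (k + 1 + 1 - j)) * ((k + 1 - j) * spanningCount j m) := by ring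
    _ = _ := by rw [← h]; ring

theorem sum_supportProb {n m : ℕ} (h : m ≤ n.choose 2) :
    ∑ j ∈ Finset.range (n + 1), supportProb n m j = 1 := by
  have hT : (((n.choose 2).choose m : ℕ) : ℝ) ≠ 0 := by exact_mod_cast (Nat.choose_pos h).ne'
  simp only [supportProb]
  rw [← Finset.sum_div, ← Nat.cast_sum, sum_choose_mul_spanningCount, div_self hT]

/-- The second moment of the number of detached nodes around `p * n`. -/
theorem sum_sq_mul_supportProb {n m : ℕ} (hn : 2 ≤ n) (h : m ≤ n.choose 2) (p : ℝ) :
    ∑ j ∈ Finset.range (n + 1), ((n : ℝ) - j - p * n) ^ 2 * supportProb n m j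
      = n * (n - 1) * (((n - 2).choose 2).choose m / (n.choose 2).choose m)
        + (1 - 2 * p * n) * (n * (((n - 1).choose 2).choose m / (n.choose 2).choose m))
        + p ^ 2 * n ^ 2 := by
  obtain ⟨k, rfl⟩ := Nat.exists_eq_add_of_le' hn
  have hT : ((((k + 2).choose 2).choose m : ℕ) : ℝ) ≠ 0 := by
    exact_mod_cast (Nat.choose_pos h).ne'
  have e0 := sum_supportProb h
  have e1 : ∑ j ∈ Finset.range (k + 2 + 1), (((k + 2 : ℕ) : ℝ) - j) * supportProb (k + 2) m j
      = (k + 2 : ℕ) * (((k + 2 - 1).choose 2).choose m / ((k + 2).choose 2).choose m) := by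
    rw [← mul_div_assoc, eq_div_iff hT, Finset.sum_mul]
    have := sum_sub_mul_choose_mul_spanningCount (k + 1) m
    rw [show k + 2 - 1 = k + 1 from rfl, ← Nat.cast_mul, ← this, Nat.cast_sum]
    refine Finset.sum_congr rfl fun j hj => ?_
    have hj : j ≤ k + 2 := by have := Finset.mem_range.1 hj; omega
    rw [supportProb, mul_assoc, div_mul_cancel₀ _ hT, ← Nat.cast_sub hj, ← Nat.cast_mul]
  have e2 : ∑ j ∈ Finset.range (k + 2 + 1),
      (((k + 2 : ℕ) : ℝ) - j) * ((((k + 2 : ℕ) : ℝ) - j - 1) * supportProb (k + 2) m j)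
      = (k + 2 : ℕ) * (((k + 2 : ℕ) : ℝ) - 1)
        * (((k + 2 - 2).choose 2).choose m / ((k + 2).choose 2).choose m) := by
    rw [← mul_div_assoc, eq_div_iff hT, Finset.sum_mul]
    have := sum_sub_mul_sub_mul_choose_mul_spanningCount k m
    rw [show k + 2 - 2 = k from rfl, show ((k + 2 : ℕ) : ℝ) - 1 = ((k + 1 : ℕ) : ℝ) by
      push_cast; ring, mul_assoc, ← Nat.cast_mul, ← Nat.cast_mul, ← this, Nat.cast_sum]
    refine Finset.sum_congr rfl fun j hj => ?_
    have hj : j ≤ k + 2 := by have := Finset.mem_range.1 hj; omega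
    -- At `j = k + 2` the truncated `k + 1 - j` differs from the real `-1`, but the other factor
    -- vanishes.
    rcases hj.eq_or_lt with rfl | hj'
    · simp
    · rw [supportProb, mul_assoc, mul_assoc, div_mul_cancel₀ _ hT, Nat.cast_mul (k + 2 - j),
        Nat.cast_mul (k + 1 - j), Nat.cast_sub hj, Nat.cast_sub (show j ≤ k + 1 by omega)]
      push_cast
      ring
  calc ∑ j ∈ Finset.range (k + 2 + 1),
        (((k + 2 : ℕ) : ℝ) - j - p * (k + 2 : ℕ)) ^ 2 * supportProb (k + 2) m j
      = ∑ j ∈ Finset.range (k + 2 + 1),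
          ((((k + 2 : ℕ) : ℝ) - j) * ((((k + 2 : ℕ) : ℝ) - j - 1) * supportProb (k + 2) m j)
          + (1 - 2 * p * (k + 2 : ℕ)) * ((((k + 2 : ℕ) : ℝ) - j) * supportProb (k + 2) m j)
          + p ^ 2 * ((k + 2 : ℕ) : ℝ) ^ 2 * supportProb (k + 2) m j) := by
        refine Finset.sum_congr rfl fun j _ => ?_
        ring
    _ = _ := by
        rw [Finset.sum_add_distrib, Finset.sum_add_distrib, ← Finset.mul_sum, ← Finset.mul_sum,
          e0, e1, e2, mul_one]

/-- By Chebyshev's inequality at least half of the mass lies within `δ * N` of the typical value. At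
most `N + 1` values of `j` share it, so one of them has mass at least `1 / (2 * (N + 1))`. -/
theorem eventually_exists_le_supportProb
    (hm : Tendsto (fun n : ℕ => (m n : ℝ) / n) atTop (𝓝 (c / 2)))
    (hN : Tendsto (fun n : ℕ => (N n : ℝ) / n) atTop (𝓝 ν)) (hν : 0 < ν) {δ : ℝ} (hδ : 0 < δ) :
    ∀ᶠ n in atTop, ∃ j ≤ N n, |(N n : ℝ) - j - Real.exp (-(c / ν)) * N n| ≤ δ * N n ∧
      1 / (2 * ((N n : ℝ) + 1)) ≤ supportProb (N n) (m n) j := by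
  set p := Real.exp (-(c / ν)) with hp
  have hNtop : Tendsto (fun n : ℕ => (N n : ℝ)) atTop atTop := by
    have := hN.pos_mul_atTop hν tendsto_natCast_atTop_atTop
    refine this.congr' ?_
    filter_upwards [eventually_gt_atTop 0] with n hn
    rw [div_mul_cancel₀ _ (by positivity)]
  have hinv : Tendsto (fun n : ℕ => 1 / (N n : ℝ)) atTop (𝓝 0) := by
    simp only [one_div]
    exact hNtop.inv_tendsto_atTop
  have h1 := tendsto_choose_sub_div_choose hm hN hν 1
  have h2 := tendsto_choose_sub_div_choose hm hN hν 2
  rw [Nat.cast_one, one_mul, ← hp] at h1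
  rw [show Real.exp (-((2 : ℕ) * (c / ν))) = p ^ 2 by
    rw [hp, ← Real.exp_nat_mul]; congr 1; push_cast; ring] at h2
  -- The second moment around `p * N`, divided by `N²`, tends to `p² - 2p² + p² = 0`.
  have hV := (((hinv.const_sub 1).mul h2).add ((hinv.sub_const (2 * p)).mul h1)).add_const (p ^ 2)
  rw [show (1 - 0) * p ^ 2 + (0 - 2 * p) * p + p ^ 2 = 0 by ring] at hV
  filter_upwards [hV.eventually_lt_const (show 0 < δ ^ 2 / 2 by positivity),
    hNtop.eventually_ge_atTop 2,
    eventually_lt_of_tendsto_div hm (tendsto_choose_two_div hN) (by positivity)] with n hn hN2 hmM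
  have hN0 : (0 : ℝ) < N n := by linarith
  have hvar := sum_sq_mul_supportProb (by exact_mod_cast hN2) hmM.le p
  by_contra! hcon
  have hsum := sum_supportProb hmM.le
  have hle : ∑ j ∈ Finset.range (N n + 1), supportProb (N n) (m n) j
      ≤ ∑ j ∈ Finset.range (N n + 1), (1 / (2 * ((N n : ℝ) + 1))
        + ((N n : ℝ) - j - p * N n) ^ 2 * supportProb (N n) (m n) j / (δ * N n) ^ 2) := by
    refine Finset.sum_le_sum fun j hj => ?_
    have hj : j ≤ N n := by have := Finset.mem_range.1 hj; omega
    have h0 := supportProb_nonneg (N n) (m n) j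
    rcases le_or_gt |(N n : ℝ) - j - p * N n| (δ * N n) with h | h
    · have h3 := (hcon j hj h).le
      have h4 : 0 ≤ ((N n : ℝ) - j - p * N n) ^ 2 * supportProb (N n) (m n) j / (δ * N n) ^ 2 := by
        positivity
      linarith
    · have h3 : (δ * N n) ^ 2 ≤ ((N n : ℝ) - j - p * N n) ^ 2 := by
        rw [← sq_abs ((N n : ℝ) - j - p * N n)]
        gcongr
      have h4 : supportProb (N n) (m n) j
          ≤ ((N n : ℝ) - j - p * N n) ^ 2 * supportProb (N n) (m n) j / (δ * N n) ^ 2 := by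
        rw [le_div_iff₀ (by positivity), mul_comm]
        gcongr
      have h5 : 0 ≤ 1 / (2 * ((N n : ℝ) + 1)) := by positivity
      linarith
  rw [hsum, Finset.sum_add_distrib, ← Finset.sum_div (Finset.range (N n + 1))
    (fun j : ℕ => ((N n : ℝ) - j - p * N n) ^ 2 * supportProb (N n) (m n) j), hvar, Finset.sum_const, Finset.card_range,
    nsmul_eq_mul] at hle
  have h6 : ((N n + 1 : ℕ) : ℝ) * (1 / (2 * ((N n : ℝ) + 1))) = 1 / 2 := by
    push_cast; field_simp
  rw [h6] at hle
  have h7 : 1 / 2 * (δ * N n) ^ 2 ≤ (N n * (N n - 1) *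
      (((N n - 2).choose 2).choose (m n) / ((N n).choose 2).choose (m n))
        + (1 - 2 * p * N n) * (N n * (((N n - 1).choose 2).choose (m n)
          / ((N n).choose 2).choose (m n))) + p ^ 2 * (N n : ℝ) ^ 2) := by
    rw [← le_div_iff₀ (by positivity)]
    linarith
  have h8 := mul_lt_mul_of_pos_right hn (show 0 < (N n : ℝ) ^ 2 by positivity)
  have h9 : 1 / (N n : ℝ) * N n = 1 := by field_simp
  have h10 : (1 / (N n : ℝ)) * (N n : ℝ) ^ 2 = N n := by field_simp
  refine absurd h7 (not_le.2 (lt_of_eq_of_lt ?_ (h8.trans_eq ?_)))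
  · generalize ((((N n - 2).choose 2).choose (m n) : ℕ) : ℝ) / (((N n).choose 2).choose (m n) : ℕ)
      = A
    generalize ((((N n - 1).choose 2).choose (m n) : ℕ) : ℝ) / (((N n).choose 2).choose (m n) : ℕ)
      = B
    linear_combination (A - B) * h10
  · ring

end Concentration

/-! ### Estimates on the exponential scale. -/

theorem eventually_linear_le_exp (A B : ℝ) {ε : ℝ} (hε : 0 < ε) :
    ∀ᶠ n : ℕ in atTop, A * n + B ≤ Real.exp (n * ε) := by
  have h := tendsto_natCast_atTop_atTop (R := ℝ)
  filter_upwards [h.eventually_ge_atTop 1, h.eventually_ge_atTop (2 * (|A| + |B|) / ε ^ 2)]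
    with n h1 h2
  have h3 := Real.quadratic_le_exp_of_nonneg (x := n * ε) (by positivity)
  rw [div_le_iff₀ (by positivity)] at h2
  have h4 := mul_le_mul_of_nonneg_right h2 (show (0 : ℝ) ≤ n by positivity)
  have h5 : A * n ≤ |A| * n := by gcongr; exact le_abs_self A
  have h6 : B ≤ |B| * n := (le_abs_self B).trans (le_mul_of_one_le_right (abs_nonneg B) h1)
  have h7 : 0 ≤ n * ε := by positivity
  nlinarith

theorem log_ofReal_exp_div {n : ℕ} (hn : 0 < n) (L : ℝ) :
    ENNReal.log (ENNReal.ofReal (Real.exp (-(n * L)))) / ((n : ℝ) : EReal) = ((-L : ℝ) : EReal) := by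
  have hn' : (n : ℝ) ≠ 0 := by positivity
  rw [ENNReal.log_ofReal_of_pos (Real.exp_pos _), Real.log_exp, ← EReal.coe_div]
  congr 1
  field_simp

theorem limsup_log_div_le {P : ℕ → ENNReal} {L : ℝ}
    (h : ∀ᶠ n : ℕ in atTop, P n ≤ ENNReal.ofReal (Real.exp (-(n * L)))) :
    limsup (fun n : ℕ => ENNReal.log (P n) / ((n : ℝ) : EReal)) atTop ≤ ((-L : ℝ) : EReal) := by
  refine limsup_le_of_le (by isBoundedDefault) ?_
  filter_upwards [h, eventually_gt_atTop 0] with n hn h0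
  rw [← log_ofReal_exp_div h0]
  exact EReal.div_le_div_right_of_nonneg (by exact_mod_cast Nat.zero_le n) (ENNReal.log_monotone hn)

theorem le_liminf_log_div {P : ℕ → ENNReal} {L : ℝ}
    (h : ∀ᶠ n : ℕ in atTop, ENNReal.ofReal (Real.exp (-(n * L))) ≤ P n) :
    ((-L : ℝ) : EReal) ≤ liminf (fun n : ℕ => ENNReal.log (P n) / ((n : ℝ) : EReal)) atTop := by
  refine le_liminf_of_le (by isBoundedDefault) ?_
  filter_upwards [h, eventually_gt_atTop 0] with n hn h0
  rw [← log_ofReal_exp_div h0]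
  exact EReal.div_le_div_right_of_nonneg (by exact_mod_cast Nat.zero_le n) (ENNReal.log_monotone hn)

/-- The change of the number of nodes: `spanningCount j m` cancels between the two probabilities. -/
theorem supportProb_eq_mul {n N m j : ℕ} (hj : j ≤ N) (hm : m ≤ N.choose 2) :
    supportProb n m j = (n.choose j / N.choose j
      * (((N.choose 2).choose m : ℝ) / ((n.choose 2).choose m))) * supportProb N m j := by
  have h1 : (N.choose j : ℝ) ≠ 0 := by exact_mod_cast (Nat.choose_pos hj).ne'
  have h2 : ((N.choose 2).choose m : ℝ) ≠ 0 := by exact_mod_cast (Nat.choose_pos hm).ne'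
  unfold supportProb
  push_cast
  field_simp

/-! ### The large deviation bounds. -/

section LargeDeviations

variable {m : ℕ → ℕ} {c : ℝ}

theorem eventually_le_choose_two (hm : Tendsto (fun n : ℕ => (m n : ℝ) / n) atTop (𝓝 (c / 2))) :
    ∀ᶠ n : ℕ in atTop, m n ≤ n.choose 2 := by
  have h1 : Tendsto (fun n : ℕ => (n : ℝ) / n) atTop (𝓝 1) := by
    refine tendsto_const_nhds.congr' ?_
    filter_upwards [eventually_gt_atTop 0] with n hn
    rw [div_self (by positivity)]
  exact (eventually_lt_of_tendsto_div hm (tendsto_choose_two_div h1) (by positivity)).mono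
    fun n hn => hn.le

theorem eventually_supportProb_bounds {ν ε : ℝ}
    (hm : Tendsto (fun n : ℕ => (m n : ℝ) / n) atTop (𝓝 (c / 2))) (hν : 0 < ν) (hε : 0 < ε) :
    ∀ᶠ n : ℕ in atTop, ∀ j : ℕ, j ≤ n → (j : ℝ) ≤ ν * n →
      supportProb n (m n) j ≤ Real.exp (-(n * (shiftRate c ν (1 - j / n) - ε))) ∧
      Real.exp (-(n * (shiftRate c ν (1 - j / n) + ε))) * supportProb ⌈ν * n⌉₊ (m n) j
        ≤ supportProb n (m n) j := by
  filter_upwards [eventually_abs_log_choose_add_shiftRate_le hm hν hε, eventually_le_choose_two hm,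
    eventually_lt_of_tendsto_div hm (tendsto_choose_two_div (tendsto_ceil_mul_div hν))
      (by positivity)] with n h1 h2 h3 j hjn hjν
  have h4 := h1 j hjn hjν
  have hjK : j ≤ ⌈ν * n⌉₊ := by exact_mod_cast hjν.trans (Nat.le_ceil _)
  have p1 : (0 : ℝ) < n.choose j := by exact_mod_cast Nat.choose_pos hjn
  have p2 : (0 : ℝ) < ⌈ν * n⌉₊.choose j := by exact_mod_cast Nat.choose_pos hjK
  have p3 : (0 : ℝ) < (n.choose 2).choose (m n) := by exact_mod_cast Nat.choose_pos h2
  have p4 : (0 : ℝ) < (⌈ν * n⌉₊.choose 2).choose (m n) := by exact_mod_cast Nat.choose_pos h3.le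
  have h5 : (n.choose j : ℝ) / ⌈ν * n⌉₊.choose j
      * (((⌈ν * n⌉₊.choose 2).choose (m n) : ℝ) / ((n.choose 2).choose (m n)))
      = Real.exp (Real.log (n.choose j) - Real.log (⌈ν * n⌉₊.choose j)
        + (Real.log ((⌈ν * n⌉₊.choose 2).choose (m n))
          - Real.log ((n.choose 2).choose (m n)))) := by
    rw [Real.exp_add, Real.exp_sub, Real.exp_sub, Real.exp_log p1, Real.exp_log p2,
      Real.exp_log p3, Real.exp_log p4]
  rw [supportProb_eq_mul hjK h3.le, h5]
  rw [abs_le] at h4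
  constructor
  · refine (mul_le_of_le_one_right (Real.exp_pos _).le (supportProb_le_one _ _ _)).trans ?_
    rw [Real.exp_le_exp]
    linarith
  · refine mul_le_mul_of_nonneg_right ?_ (supportProb_nonneg _ _ _)
    rw [Real.exp_le_exp]
    linarith

theorem continuousAt_shiftRate (c ν y : ℝ) : ContinuousAt (shiftRate c ν) y := by
  have h1 : Continuous fun y : ℝ => y * Real.log y := Real.continuous_mul_log
  have h2 : Continuous fun y : ℝ => (ν - (1 - y)) * Real.log (ν - (1 - y)) :=
    Real.continuous_mul_log.comp (by fun_prop)
  have h3 : Continuous (shiftRate c ν) := by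
    unfold shiftRate
    fun_prop
  exact h3.continuousAt

open scoped Classical in
/-- The upper bound near a point. -/
theorem eventually_spatialGraphLaw_le_of_shiftRate {d : ℕ} {ν L L' : ℝ}
    (hm : Tendsto (fun n : ℕ => (m n : ℝ) / n) atTop (𝓝 (c / 2))) (hν : 0 < ν) (hL : L' < L)
    {V : Set I} (hV : ∀ z ∈ V, L < shiftRate c ν z ∧ 1 - (z : ℝ) < ν) :
    ∀ᶠ n : ℕ in atTop, spatialGraphLaw d n (m n) {X | detachedProportion X ∈ V}
      ≤ ENNReal.ofReal (Real.exp (-(n * L'))) := by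
  -- Half of the gap pays for the error in the exponent, the other half for the `n + 1` values of
  -- `j`.
  have hε : 0 < (L - L') / 2 := by linarith
  filter_upwards [eventually_supportProb_bounds hm hν hε, eventually_le_choose_two hm,
    eventually_linear_le_exp 1 1 hε, eventually_gt_atTop 0] with n h1 h2 h3 h0
  have hn : (0 : ℝ) < n := by exact_mod_cast h0
  rw [spatialGraphLaw_detachedProportion d n (m n) h2]
  refine ENNReal.ofReal_le_ofReal ?_
  have h4 : ∀ j ∈ (Finset.range (n + 1)).filter
      (fun j : ℕ => ((n : ℝ) - j) / n ∈ Subtype.val '' V),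
      supportProb n (m n) j ≤ Real.exp (-(n * (L - (L - L') / 2))) := by
    intro j hj
    obtain ⟨hj1, z, hz, hzj⟩ := Finset.mem_filter.1 hj
    have hjn : j ≤ n := by have := Finset.mem_range.1 hj1; omega
    have hz1 : (1 : ℝ) - j / n = z := by rw [hzj]; field_simp
    obtain ⟨hz2, hz3⟩ := hV z hz
    have hjν : (j : ℝ) ≤ ν * n := by
      rw [← div_le_iff₀ hn]; linarith
    refine (h1 j hjn hjν).1.trans ?_
    rw [hz1]
    gcongr
  refine (Finset.sum_le_card_nsmul _ _ _ h4).trans ?_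
  rw [nsmul_eq_mul]
  have h5 : (((Finset.range (n + 1)).filter
      (fun j : ℕ => ((n : ℝ) - j) / n ∈ Subtype.val '' V)).card : ℝ) ≤ 1 * n + 1 := by
    have := Finset.card_filter_le (Finset.range (n + 1))
      (fun j : ℕ => ((n : ℝ) - j) / n ∈ Subtype.val '' V)
    rw [Finset.card_range] at this
    rw [one_mul]
    exact_mod_cast this
  calc _ ≤ Real.exp (n * ((L - L') / 2)) * Real.exp (-(n * (L - (L - L') / 2))) := by
        gcongr
        exact h5.trans h3
    _ = Real.exp (-(n * L')) := by rw [← Real.exp_add]; congr 1; ring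

/-- Each point of `F` has its own good `ν`, which by continuity serves a neighbourhood. Compactness
leaves finitely many neighbourhoods, and each union costs only a factor 2. -/
theorem eventually_spatialGraphLaw_le {α : ℝ → ℝ} (hc : 0 < c) {d : ℕ} {L : ℝ}
    (hm : Tendsto (fun n : ℕ => (m n : ℝ) / n) atTop (𝓝 (c / 2)))
    (hα : ∀ y, 0 ≤ y → 1 - c < y → y < 1 →
      0 < α y ∧ (1 - Real.exp (-α y)) / α y = (1 - y) / c)
    {F : Set I} (hF : IsClosed F) (hL : ∀ y ∈ F, (L : EReal) < detachedRate c (α y) y) :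
    ∀ L' < L, ∀ᶠ n : ℕ in atTop, spatialGraphLaw d n (m n) {X | detachedProportion X ∈ F}
      ≤ ENNReal.ofReal (Real.exp (-(n * L'))) := by
  refine hF.isCompact.induction_on (p := fun F : Set I => ∀ L' < L, ∀ᶠ n : ℕ in atTop,
    spatialGraphLaw d n (m n) {X | detachedProportion X ∈ F}
      ≤ ENNReal.ofReal (Real.exp (-(n * L')))) ?_ ?_ ?_ ?_
  · intro L' _
    refine Eventually.of_forall fun n => ?_
    simp
  · intro S T hST hT L' hL'
    filter_upwards [hT L' hL'] with n hn
    have hsub : {X : SpatialGraph d n | detachedProportion X ∈ S}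
        ⊆ {X | detachedProportion X ∈ T} := fun X hX => hST hX
    exact (measure_mono hsub).trans hn
  · intro S T hS hT L' hL'
    have h1 : (L' + L) / 2 < L := by linarith
    filter_upwards [hS _ h1, hT _ h1,
      eventually_linear_le_exp 0 2 (show 0 < (L - L') / 2 by linarith)] with n hn1 hn2 hn3
    refine ((measure_union_le {X | detachedProportion X ∈ S}
      {X | detachedProportion X ∈ T}).trans (add_le_add hn1 hn2)).trans ?_
    rw [← ENNReal.ofReal_add (Real.exp_pos _).le (Real.exp_pos _).le]
    refine ENNReal.ofReal_le_ofReal ?_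
    rw [zero_mul, zero_add] at hn3
    calc _ = 2 * Real.exp (-(n * ((L' + L) / 2))) := by ring
      _ ≤ Real.exp (n * ((L - L') / 2)) * Real.exp (-(n * ((L' + L) / 2))) := by gcongr
      _ = Real.exp (-(n * L')) := by rw [← Real.exp_add]; congr 1; ring
  · intro y hy
    obtain ⟨ν, hν, hyν, hLν⟩ := exists_lt_shiftRate hc y.2.1 y.2.2 (hα y y.2.1) (hL y hy)
    refine ⟨{z : I | L < shiftRate c ν z ∧ 1 - (z : ℝ) < ν}, mem_nhdsWithin_of_mem_nhds ?_,
      fun L' hL' => eventually_spatialGraphLaw_le_of_shiftRate hm hν hL' fun z hz => hz⟩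
    have h1 : ContinuousAt (fun z : I => shiftRate c ν z) y :=
      (continuousAt_shiftRate c ν y).comp continuous_subtype_val.continuousAt
    have h2 : ContinuousAt (fun z : I => 1 - (z : ℝ)) y := by fun_prop
    exact (h1.eventually_const_lt hLν).and (h2.eventually_lt_const hyν)

open scoped Classical in
/-- The lower bound at a point between the threshold `1 - c` and `1`. -/
theorem eventually_le_spatialGraphLaw {d : ℕ} {a ε : ℝ} (hc : 0 < c) (hε : 0 < ε)
    (hm : Tendsto (fun n : ℕ => (m n : ℝ) / n) atTop (𝓝 (c / 2)))
    {U : Set I} (hU : IsOpen U) {y : I} (hy : y ∈ U) (hy0 : 0 < (y : ℝ))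
    (ha : 0 < a) (h : (1 - Real.exp (-a)) / a = (1 - y) / c) :
    ∀ᶠ n : ℕ in atTop, ENNReal.ofReal (Real.exp (-(n * (shiftRate c (c / a) y + ε))))
      ≤ spatialGraphLaw d n (m n) {X | detachedProportion X ∈ U} := by
  set ν := c / a with hνdef
  have hν : 0 < ν := by positivity
  have hyν : 1 - (y : ℝ) < ν := one_sub_lt_div_of_eq hc ha h
  -- This `ν` makes `(1 - y) * n` the typical number of non-detached nodes in the graph on `ν * n`
  -- nodes.
  have hy' : (y : ℝ) = 1 - (1 - Real.exp (-a)) * ν := by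
    rw [div_eq_div_iff ha.ne' hc.ne'] at h
    rw [hνdef, mul_div_assoc', h]
    field_simp
    ring
  obtain ⟨O, hO, rfl⟩ := isOpen_induced_iff.1 hU
  have hnhds : ∀ᶠ z : ℝ in 𝓝 (y : ℝ),
      z ∈ O ∧ shiftRate c ν z < shiftRate c ν y + ε / 3 ∧ 0 < z ∧ 1 - z < ν := by
    have h1 : ∀ᶠ z : ℝ in 𝓝 (y : ℝ), z ∈ O := hO.mem_nhds hy
    have h2 : ContinuousAt (fun z : ℝ => 1 - z) y := by fun_prop
    exact h1.and (((continuousAt_shiftRate c ν y).eventually_lt_const (by linarith)).and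
      ((lt_mem_nhds hy0).and (h2.eventually_lt_const hyν)))
  obtain ⟨r, hr, hball⟩ := Metric.eventually_nhds_iff.1 hnhds
  have hN := tendsto_ceil_mul_div hν
  have hε3 : 0 < ε / 3 := by positivity
  -- One third of `ε` each pays for the change of the number of nodes, for moving from `y` to `1 -
  -- j/n`, and for the factor `1 / (2 * (K + 1))`. The value of `δ` gives a deviation of at most `r
  -- / 2` after division by `n`, since `K / n ≤ ν + 1`.
  filter_upwards [eventually_supportProb_bounds hm hν hε3, eventually_le_choose_two hm,
    eventually_exists_le_supportProb hm hN hν (δ := r / (2 * (ν + 1))) (by positivity),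
    eventually_linear_le_exp (2 * (ν + 1)) 2 hε3,
    Metric.tendsto_nhds.1 hN (min (r / 2) 1) (by positivity), eventually_gt_atTop 0]
    with n h1 h2 h3 h4 h5 h0
  have hn : (0 : ℝ) < n := by exact_mod_cast h0
  obtain ⟨j, hjN, hj1, hj2⟩ := h3
  rw [show c / ν = a by rw [hνdef]; field_simp] at hj1
  rw [Real.dist_eq] at h5
  set K := ⌈ν * n⌉₊ with hK
  have hK1 : (K : ℝ) / n ≤ ν + 1 := by
    have := (abs_lt.1 h5).2
    linarith [min_le_right (r / 2) 1]
  have hz : |(1 - (j : ℝ) / n) - y| < r := by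
    have e1 : (1 - (j : ℝ) / n) - y = ((K : ℝ) - j - Real.exp (-a) * K) / n
        - (1 - Real.exp (-a)) * ((K : ℝ) / n - ν) := by
      rw [hy']; field_simp; ring
    have e2 : |((K : ℝ) - j - Real.exp (-a) * K) / n| ≤ r / 2 := by
      rw [abs_div, abs_of_pos hn]
      calc _ ≤ r / (2 * (ν + 1)) * K / n := by gcongr
        _ = r / (2 * (ν + 1)) * (K / n) := by ring
        _ ≤ r / (2 * (ν + 1)) * (ν + 1) := by gcongr
        _ = r / 2 := by field_simp
    have e3 : |(1 - Real.exp (-a)) * ((K : ℝ) / n - ν)| < r / 2 := by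
      have h6 : |1 - Real.exp (-a)| ≤ 1 := by
        have h7 : Real.exp (-a) ≤ 1 := Real.exp_le_one_iff.2 (by linarith)
        rw [abs_of_nonneg (by linarith)]
        linarith [Real.exp_pos (-a)]
      rw [abs_mul]
      exact (mul_le_of_le_one_left (abs_nonneg _) h6).trans_lt (h5.trans_le (min_le_left _ _))
    rw [e1]
    exact (abs_sub _ _).trans_lt (by linarith)
  obtain ⟨b1, b2, b3, b4⟩ := hball hz
  -- The comparison graph may have more than `n` nodes; positivity of `y`, hence of `1 - j/n`
  -- nearby, ensures that `j` is admissible for `n`.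
  have hjn : j ≤ n := by
    have : (j : ℝ) / n < 1 := by linarith
    rw [div_lt_one hn] at this
    exact_mod_cast this.le
  have hjν : (j : ℝ) ≤ ν * n := by
    rw [← div_le_iff₀ hn]; linarith
  rw [spatialGraphLaw_detachedProportion d n (m n) h2]
  refine ENNReal.ofReal_le_ofReal ?_
  have hmem : j ∈ (Finset.range (n + 1)).filter
      (fun j : ℕ => ((n : ℝ) - j) / n ∈ Subtype.val '' (Subtype.val ⁻¹' O : Set I)) := by
    have e : ((n : ℝ) - j) / n = 1 - j / n := by field_simp
    refine Finset.mem_filter.2 ⟨Finset.mem_range.2 (by omega),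
      ⟨1 - j / n, b3.le, sub_le_self _ (by positivity)⟩, b1, e.symm⟩
  refine le_trans ?_ (Finset.single_le_sum (f := fun j => supportProb n (m n) j)
    (fun i _ => supportProb_nonneg _ _ _) hmem)
  refine le_trans ?_ (h1 j hjn hjν).2
  have h6 : Real.exp (-(n * (ε / 3))) ≤ supportProb K (m n) j := by
    refine le_trans ?_ hj2
    rw [Real.exp_neg, ← one_div]
    refine one_div_le_one_div_of_le (by positivity) (le_trans ?_ h4)
    rw [div_le_iff₀ hn] at hK1
    linarith
  calc Real.exp (-(n * (shiftRate c ν y + ε)))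
      = Real.exp (-(n * (shiftRate c ν y + ε / 3 + ε / 3))) * Real.exp (-(n * (ε / 3))) := by
        rw [← Real.exp_add]; congr 1; ring
    _ ≤ _ := by gcongr

/-- The direct argument needs `0 < y` and `1 - c < y < 1`. Any other `y` of finite rate is
approached from such points along a segment, on which convexity controls the rate. -/
theorem neg_detachedRate_le_liminf {α : ℝ → ℝ} (hc : 0 < c) {d : ℕ}
    (hm : Tendsto (fun n : ℕ => (m n : ℝ) / n) atTop (𝓝 (c / 2)))
    (hα : ∀ y, 0 ≤ y → 1 - c < y → y < 1 →
      0 < α y ∧ (1 - Real.exp (-α y)) / α y = (1 - y) / c)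
    {U : Set I} (hU : IsOpen U) {y : I} (hy : y ∈ U) :
    -(detachedRate c (α y) y) ≤ liminf (fun n : ℕ => ENNReal.log (spatialGraphLaw d n (m n)
      {X | detachedProportion X ∈ U}) / ((n : ℝ) : EReal)) atTop := by
  set ℓ := liminf (fun n : ℕ => ENNReal.log (spatialGraphLaw d n (m n)
      {X | detachedProportion X ∈ U}) / ((n : ℝ) : EReal)) atTop with hℓ
  have hreg : ∀ z : I, z ∈ U → 0 < (z : ℝ) → 1 - c < z → (z : ℝ) < 1 → ∀ L : ℝ,
      detachedRate c (α z) z < L → ((-L : ℝ) : EReal) ≤ ℓ := by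
    intro z hz hz0 hzc hz1 L hL
    obtain ⟨ha, h⟩ := hα z hz0.le hzc hz1
    rw [detachedRate_eq_tiltRate hc ha hzc hz1, tiltRate_eq_shiftRate hc ha h,
      EReal.coe_lt_coe_iff] at hL
    have := eventually_le_spatialGraphLaw (d := d) hc (sub_pos.2 hL) hm hU hz hz0 ha h
    rw [add_sub_cancel] at this
    exact le_liminf_log_div this
  rcases eq_or_ne (detachedRate c (α y) y) ⊤ with htop | htop
  · rw [htop, EReal.neg_top]; exact bot_le
  have hnot : ¬((y : ℝ) < 1 - c ∨ (y : ℝ) = 1) := fun h => htop (by rw [detachedRate, if_pos h])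
  obtain ⟨hyc, hy1⟩ := not_or.1 hnot
  have hy1 : (y : ℝ) < 1 := lt_of_le_of_ne y.2.2 hy1
  have hyc : 1 - c ≤ y := not_lt.1 hyc
  have hnonneg := (isGoodRateFunction_detachedRate hc hα).nonneg y
  obtain ⟨A, hA⟩ : ∃ A : ℝ, detachedRate c (α y) y = A :=
    ⟨_, (EReal.coe_toReal htop (ne_bot_of_le_ne_bot EReal.zero_ne_bot hnonneg)).symm⟩
  have hy0 : 0 ≤ (y : ℝ) := y.2.1
  -- The midpoint between `y` and 1 lies in the regular range and has finite rate, and so does every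
  -- point moved slightly from `y` towards it.
  let w : I := ⟨(1 + y) / 2, by linarith, by linarith⟩
  have hw : (w : ℝ) = (1 + y) / 2 := rfl
  obtain ⟨B, hB⟩ : ∃ B : ℝ, detachedRate c (α w) w = B := by
    obtain ⟨ha, -⟩ := hα w w.2.1 (by linarith) (by linarith)
    exact ⟨_, detachedRate_eq_tiltRate hc ha (by linarith) (by linarith)⟩
  rw [hA]
  by_contra! hcon
  obtain ⟨q, hq1, hq2⟩ := EReal.lt_iff_exists_real_btwn.1 hcon
  rw [← EReal.coe_neg, EReal.coe_lt_coe_iff] at hq2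
  obtain ⟨O, hO, rfl⟩ := isOpen_induced_iff.1 hU
  have h1 : ∀ᶠ s : ℝ in 𝓝 0, (1 - s) * y + s * w ∈ O := by
    have hcont : ContinuousAt (fun s : ℝ => (1 - s) * (y : ℝ) + s * w) 0 := by fun_prop
    exact hcont.eventually_mem (hO.mem_nhds (by simpa using hy))
  have h2 : ∀ᶠ s : ℝ in 𝓝 0, (1 - s) * A + s * B < -q := by
    have hcont : ContinuousAt (fun s : ℝ => (1 - s) * A + s * B) 0 := by fun_prop
    refine hcont.eventually_lt_const ?_
    simp only [sub_zero, one_mul, zero_mul, add_zero]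
    linarith
  have h3 : ∀ᶠ s : ℝ in 𝓝[>] 0, s ∈ Set.Ioo (0 : ℝ) 1 := Ioo_mem_nhdsGT one_pos
  obtain ⟨s, ⟨hs1, hs2⟩, hs0, hs3⟩ :=
    (((h1.and h2).filter_mono nhdsWithin_le_nhds).and h3).exists
  obtain ⟨x, hx1, hx2⟩ := isConvexOnUnitInterval_detachedRate hc hα
    (x := ((y : ℝ), A)) ⟨y, rfl, hA.le⟩ (y := ((w : ℝ), B)) ⟨w, rfl, hB.le⟩
    (a := 1 - s) (b := s) (by linarith) hs0.le (by ring)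
  simp only [Prod.smul_mk, Prod.mk_add_mk, smul_eq_mul] at hx1 hx2
  have hpos : 0 < s * (w - y) := mul_pos hs0 (by rw [hw]; linarith)
  have hlt : 0 < (1 - s) * (w - y) := mul_pos (by linarith) (by rw [hw]; linarith)
  have hfin := hreg x (by rw [Set.mem_preimage, hx1]; exact hs1) (by rw [hx1]; linarith)
    (by rw [hx1]; linarith) (by rw [hx1]; linarith) (-q)
    (hx2.trans_lt (EReal.coe_lt_coe_iff.2 hs2))
  rw [neg_neg] at hfin
  exact absurd hq1 (not_lt.2 hfin)

theorem satisfiesLDP_detachedProportion {α : ℝ → ℝ} (hc : 0 < c) (d : ℕ)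
    (hm : Tendsto (fun n : ℕ => (m n : ℝ) / n) atTop (𝓝 (c / 2)))
    (hα : ∀ y, 0 ≤ y → 1 - c < y → y < 1 →
      0 < α y ∧ (1 - Real.exp (-α y)) / α y = (1 - y) / c) :
    SatisfiesLDP (fun n : ℕ => spatialGraphLaw d n (m n)) (fun _ X => detachedProportion X)
      (fun y : I => detachedRate c (α y) y) := by
  constructor
  · intro F hF
    by_contra! hcon
    rw [EReal.neg_lt_comm] at hcon
    obtain ⟨L, hL1, hL2⟩ := EReal.lt_iff_exists_real_btwn.1 hcon
    obtain ⟨L₂, hL3, hL4⟩ := EReal.lt_iff_exists_real_btwn.1 hL2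
    have h := limsup_log_div_le (eventually_spatialGraphLaw_le (d := d) hc hm hα hF
      (fun y hy => hL4.trans_le (iInf₂_le y hy)) L (EReal.coe_lt_coe_iff.1 hL3))
    rw [EReal.coe_neg, ← EReal.le_neg] at h
    exact absurd hL1 (not_lt.2 h)
  · intro U hU
    rw [EReal.neg_le]
    exact le_iInf₂ fun y hy => EReal.neg_le.1 (neg_detachedRate_le_liminf hc hm hα hU hy)

end LargeDeviations

/-! ### The theorem. -/

theorem rho_pos (d : ℕ) : 0 < rho d :=
  div_pos (Real.rpow_pos_of_pos Real.pi_pos _) (Real.Gamma_pos_of_pos (by positivity))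

theorem mainTheorem3 (d : ℕ) (hd : 0 < d) (t : ℝ) (ht : 0 < t) (lam : ℕ → ℕ)
    (hlam : Tendsto (fun n : ℕ => (lam n : ℝ) / (n : ℝ)) atTop (𝓝 (rho d * t / 2))) :
    ∃ α : ℝ → ℝ,
      (∀ y : ℝ, 0 ≤ y → 1 - rho d * t < y → y < 1 →
        0 < α y ∧
        ∀ a : ℝ, a ≠ 0 → ((1 - Real.exp (-a)) / a = (1 - y) / (rho d * t) ↔ a = α y)) ∧
      IsGoodRateFunction (fun y : I => detachedRate (rho d * t) (α y) y) ∧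
      IsConvexOnUnitInterval (fun y : I => detachedRate (rho d * t) (α y) y) ∧
      SatisfiesLDP (fun n : ℕ => spatialGraphLaw d n (lam n))
        (fun _ X => detachedProportion X)
        (fun y : I => detachedRate (rho d * t) (α y) y) := by
  have hc : 0 < rho d * t := mul_pos (rho_pos d) ht
  have hex : ∀ y : ℝ, ∃ a : ℝ, 1 - rho d * t < y → y < 1 →
      0 < a ∧ (1 - Real.exp (-a)) / a = (1 - y) / (rho d * t) := by
    intro y
    by_cases h : 1 - rho d * t < y ∧ y < 1
    · obtain ⟨a, ha⟩ := exists_one_sub_exp_neg_div_eq (q := (1 - y) / (rho d * t))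
        (div_pos (by linarith [h.2]) hc) (by rw [div_lt_one hc]; linarith [h.1])
      exact ⟨a, fun _ _ => ha⟩
    -- Outside the range the parameter does not enter the rate, so any value will do.
    · exact ⟨0, fun h1 h2 => absurd ⟨h1, h2⟩ h⟩
  choose α hα using hex
  have hα' : ∀ y, 0 ≤ y → 1 - rho d * t < y → y < 1 →
      0 < α y ∧ (1 - Real.exp (-α y)) / α y = (1 - y) / (rho d * t) := fun y _ => hα y
  refine ⟨α, fun y _ h1 h2 => ?_, isGoodRateFunction_detachedRate hc hα',
    isConvexOnUnitInterval_detachedRate hc hα', satisfiesLDP_detachedProportion hc d hlam hα'⟩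
  obtain ⟨ha, h⟩ := hα y h1 h2
  refine ⟨ha, fun a ha0 => ⟨fun h3 => ?_, fun h3 => h3 ▸ h⟩⟩
  exact one_sub_exp_neg_div_inj ha0 ha.ne' (h3.trans h.symm)
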